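/- Let $(X,L)$ be a polarised complex projective variety of dimension $n$ whose homogeneous coordinate ring $R=\bigoplus_{k\ge 0}R_k$, $R_k=H^0(X,L^k)$, is generated by $R_1$ (as may be assumed after rescaling $L$), and put $h(m)=\dim H^0(X,L^m)$. A test-configuration of exponent $r\ge 1$ for $(X,L)$ is a flat $\mathbb{C}^*$-equivariant projective morphism $\pi\colon\mathcal{X}\to\mathbb{C}$ with a $\pi$-very ample linearised line bundle $\mathcal{L}$ and an isomorphism of the fibre over $1$ with $(X,L^r)$. It is encoded by its section ring $\bigoplus_k H^0(\mathcal{X},\mathcal{L}^k)$, a flat finitely generated graded $\mathbb{C}[t]$-algebra with a compatible $\mathbb{Z}$-grading by weights in which $t$ has weight $1$. For $m=rk$ it defines an increasing filtration of $H^0(X,L^{m})$: $F_iH^0(X,L^{m})$ is the set of restrictions to the fibre over $1$ of the sections of $\mathcal{L}^{k}$ of weight $i$. Let $\mathrm{gr}_i=F_i/F_{i-1}$, $w(m)=\sum_i(-i)\dim\mathrm{gr}_iH^0(X,L^m)$ and $d(m)=\sum_i i^2\dim\mathrm{gr}_iH^0(X,L^m)$. For large multiples $m$ of $r$ we have $h(m)=a_0m^n+\cdots$,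 $w(m)=b_0m^{n+1}+\cdots$, $d(m)=c_0m^{n+2}+\cdots$, and the $L^2$ norm is $\|(\mathcal{X},\mathcal{L})\|_{L^2}=(c_0-b_0^2/a_0)^{1/2}$. Let $(\mathcal{X},\mathcal{L})$, $(\mathcal{X}',\mathcal{L}')$ be test-configurations for $(X,L)$ of exponents $r$, $r'$. For $m$ a common multiple of $r,r'$ let $A_m,B_m$ be commuting diagonalisable endomorphisms of $H^0(X,L^m)$ with integral eigenvalues whose weight filtrations (sums of eigenspaces with eigenvalue $\le i$) are the filtrations given by $(\mathcal{X},\mathcal{L})$ and $(\mathcal{X}',\mathcal{L}')$, and let $\bar P(m)=\mathrm{Tr}(A_mB_m)-w(m)w'(m)/h(m)$. The scalar product is $$\langle(\mathcal{X},\mathcal{L}),(\mathcal{X}',\mathcal{L}')\rangle=\limsup_{k\to\infty}\ m^{-n-2}\,\bar P(m),\qquad m=krr'.$$ For a finite-dimensional complex vector space $V$ the spherical (Tits) building of $GL(V)$ is the set of non-trivial flags in $V$ with strictly increasing real weights, modulo positive rescaling and shift of the weights. The Tits distance of two points is the angle, for the Killing form, between the infinitesimal generators of commuting special linear (real) one-parameter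 subgroups representing them. Let $\Delta_m$ be the building of $GL(H^0(X,L^m)^\vee)$, with Tits metric $\rho_m$. For $r\mid m$, $(\mathcal{X},\mathcal{L})$ defines the point $\iota_{r,m/r}(\mathcal{X},\mathcal{L})\in\Delta_m$ given by the flag dual to the filtration of $H^0(X,L^m)$ above, i.e. the class of $(\mathcal{X},\mathcal{L}^{m/r})$ (provided this flag is non-trivial). The pseudo-metric on $\Delta=\varinjlim\Delta_m$ is $$\rho((\mathcal{X},\mathcal{L}),(\mathcal{X}',\mathcal{L}'))=\liminf_{k\to\infty}\ \rho_{krr'}\big(\iota_{r,kr'}(\mathcal{X},\mathcal{L}),\iota_{r',kr}(\mathcal{X}',\mathcal{L}')\big).$$ **Proposition.** If both test-configurations have positive $L^2$ norm, then $$\rho((\mathcal{X},\mathcal{L}),(\mathcal{X}',\mathcal{L}'))=\arccos\frac{\langle(\mathcal{X},\mathcal{L}),(\mathcal{X}',\mathcal{L}')\rangle}{\|(\mathcal{X},\mathcal{L})\|_{L^2}\,\|(\mathcal{X}',\mathcal{L}')\|_{L^2}}.$$ Moreover the scalar product is the limit (in the sense of $\limsup$) of the Killing-form pairings: with $m=krr'$,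 $$\langle(\mathcal{X},\mathcal{L}),(\mathcal{X}',\mathcal{L}')\rangle=\limsup_{k\to\infty}\frac{\kappa_m(A_m^\vee,B_m^\vee)}{2\,h(m)\,m^{n+2}},$$ where $\kappa_m$ is the Killing form of $\mathfrak{gl}(H^0(X,L^m)^\vee)$ (which is that of $\mathfrak{sl}$ on traceless parts) and $A_m^\vee,B_m^\vee$ are commuting generators of the two dual weighted flags. -/

import Mathlib

universe u v

open Filter Module

noncomputable section

/-! ### Polarised varieties -/

/-- A polarised complex projective variety `(X, L)`, given by its homogeneous coordinate ring
`R = ⨁ₖ Rₖ`, `Rₖ = H⁰(X, Lᵏ)`: an `ℕ`-graded integral domain over `ℂ` with `R₀ = ℂ`,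
finite-dimensional graded pieces, and generated by `R₁` (so `X = Proj R` and `L = 𝒪(1)`). -/
structure PolarisedVariety where
  /-- the homogeneous coordinate ring `R` -/
  coordRing : Type u
  [commRing : CommRing coordRing]
  [isDomain : IsDomain coordRing]
  [algebra : Algebra ℂ coordRing]
  /-- the graded piece `Rₖ = H⁰(X, Lᵏ)` -/
  sec : ℕ → Submodule ℂ coordRing
  [graded : GradedAlgebra sec]
  [finite_sec : ∀ k, FiniteDimensional ℂ (sec k)]
  /-- `H⁰(X, 𝒪) = ℂ` -/
  sec_zero : sec 0 = 1
  /-- `R` is generated by `R₁` -/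
  adjoin_sec_one : Algebra.adjoin ℂ (sec 1 : Set coordRing) = ⊤
  /-- the dimension `n` of `X` -/
  dim : ℕ
  /-- the affine cone `Spec R` over `X` has dimension `n + 1` -/
  ringKrullDim_eq : ringKrullDim coordRing = dim + 1

attribute [instance] PolarisedVariety.commRing PolarisedVariety.isDomain
  PolarisedVariety.algebra PolarisedVariety.graded PolarisedVariety.finite_sec

namespace PolarisedVariety

/-- The Hilbert function `h(k) = dim H⁰(X, Lᵏ)`. -/
def hilbert (X : PolarisedVariety.{u}) (k : ℕ) : ℝ := finrank ℂ (X.sec k)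

end PolarisedVariety

/-! ### Test-configurations -/

/-- A test-configuration `π : (𝒳, ℒ) → 𝔸¹` of exponent `r` for `(X, L)`, with `ℒ` a
`π`-very ample `ℂˣ`-linearised line bundle, given by its equivariant section ring over
`𝔸¹ = Spec ℂ[t]`, namely `S = ⨁ₖ H⁰(𝒳, ℒᵏ)` (so that `𝒳 = Proj S` over `Spec ℂ[t]` and
`ℒ = 𝒪(1)`).  The `ℂˣ`-action is the decomposition of each `H⁰(𝒳, ℒᵏ)` into weight spaces
`grade (k, i)`, `i ∈ ℤ`; the coordinate `t` of the base has weight `1`. -/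
structure TestConfiguration (X : PolarisedVariety.{u}) (r : ℕ) where
  /-- the exponent is positive -/
  exponent_pos : 0 < r
  /-- the section ring `S` of `(𝒳, ℒ)` -/
  sectionRing : Type v
  [commRing : CommRing sectionRing]
  [algebra : Algebra ℂ sectionRing]
  [algebraPoly : Algebra (Polynomial ℂ) sectionRing]
  [tower : IsScalarTower ℂ (Polynomial ℂ) sectionRing]
  /-- `grade (k, i)` is the weight `i` part of `H⁰(𝒳, ℒᵏ)` -/
  grade : ℕ × ℤ → Submodule ℂ sectionRing
  [graded : GradedAlgebra grade]
  /-- `π` is equivariant: the coordinate `t` on the base has weight one -/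
  base_mem : algebraMap (Polynomial ℂ) sectionRing Polynomial.X ∈ grade (0, 1)
  /-- `π` is flat -/
  flat : Module.Flat (Polynomial ℂ) sectionRing
  /-- `π` is projective: `S` is finitely generated over `ℂ[t]`, ... -/
  finiteType : Algebra.FiniteType (Polynomial ℂ) sectionRing
  /-- ... with degree zero part `ℂ[t]` -/
  grade_zero : ∀ i, ∀ s ∈ grade (0, i), s ∈ (algebraMap (Polynomial ℂ) sectionRing).range
  /-- `ℒ` is `π`-very ample: `H⁰(𝒳, ℒ)` generates `H⁰(𝒳, ℒᵏ)` for all large `k` -/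
  veryAmple : ∃ k₀, ∀ k ≥ k₀, ∀ i, ∀ s ∈ grade (k, i),
    s ∈ Algebra.adjoin (Polynomial ℂ) (⋃ j : ℤ, (grade (1, j) : Set sectionRing))
  /-- restriction of sections to the fibre over `1 ∈ 𝔸¹` -/
  fibre : sectionRing →ₐ[ℂ] X.coordRing
  /-- the fibre over `1` is `S ⧸ (t - 1)`, ... -/
  ker_fibre : RingHom.ker fibre =
    Ideal.span {algebraMap (Polynomial ℂ) sectionRing Polynomial.X - 1}
  /-- ... identified with `(X, Lʳ)`, i.e. with the graded ring `⨁ₖ H⁰(X, Lʳᵏ)` -/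
  map_fibre : ∀ k, (⨆ i : ℤ, grade (k, i)).map fibre.toLinearMap = X.sec (r * k)

attribute [instance] TestConfiguration.commRing TestConfiguration.algebra
  TestConfiguration.algebraPoly TestConfiguration.tower TestConfiguration.graded

/-! ### Weighted flags, one-parameter subgroups, the spherical building -/

/-- The Killing form of the Lie algebra `gl(V)`. -/
def glKillingForm (V : Type u) [AddCommGroup V] [Module ℂ V] :
    LinearMap.BilinForm ℂ (Module.End ℂ V) :=
  letI : LieRing (Module.End ℂ V) := LieRing.ofAssociativeRing
  killingForm ℂ (Module.End ℂ V)

/-- A flag `0 ⊊ F₁ ⊊ ⋯ ⊊ F_ℓ = V` with real weights `w₁ < ⋯ < w_ℓ`, recorded as the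
increasing right-continuous filtration `x ↦ F_x`, with `F_x = F_j` for
`w_j ≤ x < w_{j+1}` and `F_x = 0` for `x < w₁`. -/
structure WeightedFlag (V : Type u) [AddCommGroup V] [Module ℂ V] where
  toFun : ℝ → Submodule ℂ V
  mono : Monotone toFun
  exists_bot : ∃ x, toFun x = ⊥
  exists_top : ∃ x, toFun x = ⊤
  right_cont : ∀ x, (⨅ y, ⨅ _ : x < y, toFun y) ≤ toFun x

namespace WeightedFlag

variable {V : Type u} [AddCommGroup V] [Module ℂ V]

/-- The flag has length at most one. -/
def IsTrivial (F : WeightedFlag V) : Prop := ∀ x, F.toFun x = ⊥ ∨ F.toFun x = ⊤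

/-- `A` is the infinitesimal generator of a (real) one-parameter subgroup of `GL(V)` whose
weight filtration is `F`: `F_x` is the sum of the eigenspaces with eigenvalue `≤ x`
(in particular `A` is diagonalisable with real eigenvalues). -/
def IsGenerator (F : WeightedFlag V) (A : Module.End ℂ V) : Prop :=
  ∀ x, F.toFun x = ⨆ y : ℝ, ⨆ _ : y ≤ x, A.eigenspace (y : ℂ)

/-- `Tr(AB)`, where `A`, `B` are commuting infinitesimal generators (equivalently, generators of
one-parameter subgroups of a common maximal torus) with weight filtrations `F` and `G`. -/
def tracePairing (F G : WeightedFlag V) : ℝ :=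
  Classical.epsilon fun p : ℝ => ∃ A B : Module.End ℂ V,
    Commute A B ∧ F.IsGenerator A ∧ G.IsGenerator B ∧ (p : ℂ) = LinearMap.trace ℂ V (A * B)

/-- The Killing form `κ(A, B)` of `gl(V)` on commuting infinitesimal generators `A`, `B` with
weight filtrations `F` and `G`.  The centre is in the kernel of `κ`, so this is also the Killing
form of `sl(V)` on the traceless parts of `A` and `B`. -/
def killingPairing (F G : WeightedFlag V) : ℝ :=
  Classical.epsilon fun p : ℝ => ∃ A B : Module.End ℂ V,
    Commute A B ∧ F.IsGenerator A ∧ G.IsGenerator B ∧ (p : ℂ) = glKillingForm V A B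

/-- The weighted flag on `Vᵛ` dual to a weighted flag on `V`: weights change sign and subspaces
are replaced by annihilators. -/
def dual (F : WeightedFlag V) : WeightedFlag (Module.Dual ℂ V) where
  toFun x := ⨅ y, ⨅ _ : y < -x, (F.toFun y).dualAnnihilator
  mono x x' h := by
    simp only [le_iInf_iff]
    intro y hy
    exact iInf₂_le y (by linarith)
  exists_bot := by
    obtain ⟨x, hx⟩ := F.exists_top
    refine ⟨-(x + 1), eq_bot_iff.2 ((iInf₂_le x (by linarith)).trans ?_)⟩
    simp [hx]
  exists_top := by
    obtain ⟨x, hx⟩ := F.exists_bot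
    refine ⟨-x, eq_top_iff.2 ?_⟩
    simp only [le_iInf_iff]
    intro y hy
    have : F.toFun y = ⊥ := eq_bot_iff.2 (hx ▸ F.mono (by linarith))
    simp [this]
  right_cont x := by
    simp only [le_iInf_iff]
    intro y hy
    exact (iInf₂_le ((x + -y) / 2) (by linarith)).trans (iInf₂_le y (by linarith))

/-- Two systems of weights on the same flag are identified if they differ by a positive rescaling
and a shift. -/
instance setoid (V : Type u) [AddCommGroup V] [Module ℂ V] :
    Setoid {F : WeightedFlag V // ¬ F.IsTrivial} where
  r F G := ∃ c : ℝ, 0 < c ∧ ∃ b : ℝ, ∀ x, G.1.toFun (c * x + b) = F.1.toFun x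
  iseqv := by
    refine ⟨fun F => ⟨1, one_pos, 0, fun x => by simp⟩, ?_, ?_⟩
    · rintro F G ⟨c, hc, b, h⟩
      refine ⟨c⁻¹, inv_pos.2 hc, -(c⁻¹ * b), fun x => ?_⟩
      rw [← h]
      congr 1
      field_simp
      ring
    · rintro F G H ⟨c, hc, b, h⟩ ⟨c', hc', b', h'⟩
      refine ⟨c' * c, mul_pos hc' hc, c' * b + b', fun x => ?_⟩
      rw [← h, ← h']
      congr 1
      ring

end WeightedFlag

/-- The spherical building (flag complex) of `GL(V)`: non-trivial weighted flags of `V` modulo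
rescaling and shift of the weights. -/
def Building (V : Type u) [AddCommGroup V] [Module ℂ V] : Type u :=
  Quotient (WeightedFlag.setoid V)

/-- The Tits metric on the building: the angle, with respect to the Killing form, between the
infinitesimal generators `A`, `B` of commuting special linear representatives of two points. -/
def Building.titsDist {V : Type u} [AddCommGroup V] [Module ℂ V] (p q : Building V) : ℝ :=
  Classical.epsilon fun θ : ℝ =>
    ∃ (F G : {F : WeightedFlag V // ¬ F.IsTrivial}) (A B : Module.End ℂ V),
      (Quotient.mk _ F : Building V) = p ∧ (Quotient.mk _ G : Building V) = q ∧
      Commute A B ∧ F.1.IsGenerator A ∧ G.1.IsGenerator B ∧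
      LinearMap.trace ℂ V A = 0 ∧ LinearMap.trace ℂ V B = 0 ∧
      θ = Real.arccos ((glKillingForm V A B).re /
        (√(glKillingForm V A A).re * √(glKillingForm V B B).re))

/-! ### The filtration of a test-configuration -/

namespace TestConfiguration

variable {X : PolarisedVariety.{u}} {r r' : ℕ}

/-- `dim gr_i V`, with `gr_i V = F_i / F_{i-1}`. -/
def grDim {V : Type u} [AddCommGroup V] [Module ℂ V] (F : ℤ → Submodule ℂ V) (i : ℤ) : ℕ :=
  finrank ℂ (F i ⧸ (F (i - 1)).submoduleOf (F i))

/-- For `m` a multiple of the exponent `r`, the step `F_i H⁰(X, Lᵐ)` of the filtration defined by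
a test-configuration: restrictions to the fibre over `1` of sections of `ℒ^(m/r)` of weight
`i` (i.e. of sections `tⁱ s`). -/
def filt (T : TestConfiguration.{u, v} X r) (m : ℕ) (i : ℤ) : Submodule ℂ (X.sec m) :=
  ((T.grade (m / r, i)).map T.fibre.toLinearMap).comap (X.sec m).subtype

/-- The weight function `w(m) = ∑ᵢ (-i) dim gr_i H⁰(X, Lᵐ)`. -/
def weight (T : TestConfiguration.{u, v} X r) (m : ℕ) : ℝ :=
  ∑ᶠ i : ℤ, -(i : ℝ) * grDim (T.filt m) i

/-- The trace squared function `d(m) = ∑ᵢ i² dim gr_i H⁰(X, Lᵐ)`. -/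
def traceSq (T : TestConfiguration.{u, v} X r) (m : ℕ) : ℝ :=
  ∑ᶠ i : ℤ, (i : ℝ) ^ 2 * grDim (T.filt m) i

/-- The leading coefficient (coefficient of `mᵉ`) of a function of `m` that is a polynomial of
degree at most `e` on the large multiples `m` of `r`. -/
def leadingCoeff (r e : ℕ) (f : ℕ → ℝ) : ℝ :=
  limUnder atTop fun k : ℕ => f (r * k) / ((r * k : ℕ) : ℝ) ^ e

/-- The `L²` norm, `‖(𝒳, ℒ)‖² = c₀ - b₀² / a₀`, where `h(m) = a₀ mⁿ + ⋯`,
`w(m) = b₀ mⁿ⁺¹ + ⋯` and `d(m) = c₀ mⁿ⁺² + ⋯`. -/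
def l2Norm (T : TestConfiguration.{u, v} X r) : ℝ :=
  √(leadingCoeff r (X.dim + 2) T.traceSq -
    leadingCoeff r (X.dim + 1) T.weight ^ 2 / leadingCoeff r X.dim X.hilbert)

/-- Multiplication by `t`. -/
theorem filt_le_succ (T : TestConfiguration.{u, v} X r) (m : ℕ) (i : ℤ) :
    T.filt m i ≤ T.filt m (i + 1) := by
  rintro s ⟨σ, hσ, hs⟩
  refine ⟨algebraMap (Polynomial ℂ) T.sectionRing Polynomial.X * σ, ?_, ?_⟩
  · have := SetLike.mul_mem_graded T.base_mem hσ
    rw [Prod.mk_add_mk, zero_add, add_comm 1 i] at this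
    exact this
  · have h1 : T.fibre (algebraMap (Polynomial ℂ) T.sectionRing Polynomial.X) = 1 := by
      have : algebraMap (Polynomial ℂ) T.sectionRing Polynomial.X - 1 ∈ RingHom.ker T.fibre := by
        rw [T.ker_fibre]
        exact Ideal.subset_span rfl
      rw [RingHom.mem_ker, map_sub, map_one, sub_eq_zero] at this
      exact this
    simpa [h1] using hs

theorem filt_mono (T : TestConfiguration.{u, v} X r) (m : ℕ) : Monotone (T.filt m) :=
  monotone_int_of_le_succ (T.filt_le_succ m)

theorem exists_filt_top (T : TestConfiguration.{u, v} X r) (m : ℕ) (hm : r ∣ m) :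
    ∃ i, T.filt m i = ⊤ := by
  have hsup : (⨆ i, T.filt m i) = ⊤ := by
    rw [eq_top_iff]
    rintro ⟨s, hs⟩ -
    have hs' := hs
    rw [← Nat.mul_div_cancel' hm, ← T.map_fibre, Submodule.map_iSup,
      Submodule.mem_iSup_iff_exists_finsupp] at hs'
    obtain ⟨f, hf, hfs⟩ := hs'
    have hle : ∀ i, f i ∈ X.sec m := fun i => by
      have : f i ∈ (⨆ i : ℤ, T.grade (m / r, i)).map T.fibre.toLinearMap := by
        rw [Submodule.map_iSup]
        exact Submodule.mem_iSup_of_mem i (hf i)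
      rwa [T.map_fibre, Nat.mul_div_cancel' hm] at this
    have : (⟨s, hs⟩ : X.sec m) = ∑ i ∈ f.support, ⟨f i, hle i⟩ := by
      apply Subtype.ext
      rw [AddSubmonoidClass.coe_finsetSum]
      exact hfs.symm
    rw [this]
    exact Submodule.sum_mem _ fun i _ => Submodule.mem_iSup_of_mem i (hf i)
  have hc : IsCompactElement (⊤ : Submodule ℂ (X.sec m)) :=
    (Submodule.fg_iff_compact _).1 Module.Finite.fg_top
  obtain ⟨s, hs⟩ := CompleteLattice.IsCompactElement.exists_finset_of_le_iSup _ hc _ hsup.ge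
  obtain ⟨M, hM⟩ := s.exists_le
  refine ⟨M, eq_top_iff.2 (hs.trans (iSup₂_le fun i hi => T.filt_mono m (hM i hi)))⟩

/-- The weights on `H⁰(𝒳, ℒᵏ)` are bounded below, linearly in `k`. -/
theorem exists_weight_bound (T : TestConfiguration.{u, v} X r) :
    ∃ c : ℤ, ∀ (k : ℕ) (i : ℤ), i < -(c * k) → T.grade (k, i) = ⊥ := by
  classical
  obtain ⟨G, hG⟩ := T.finiteType.out
  set t : T.sectionRing := algebraMap (Polynomial ℂ) T.sectionRing Polynomial.X with ht
  have hpow : ∀ j : ℕ, t ^ j ∈ T.grade (0, (j : ℤ)) := fun j => by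
    have := SetLike.pow_mem_graded j T.base_mem
    simpa using this
  have hproj : ∀ (a b : ℕ × ℤ) (s : T.sectionRing), s ∈ T.grade a → a ≠ b →
      (DirectSum.decompose T.grade s b : T.sectionRing) = 0 := fun a b s hs hab =>
    DirectSum.decompose_of_mem_ne T.grade hs hab
  obtain ⟨c, hc⟩ : ∃ c : ℕ, ∀ g ∈ G, ∀ p ∈ (DirectSum.decompose T.grade g).support,
      p.2.natAbs ≤ c := by
    refine ⟨G.sup fun g => (DirectSum.decompose T.grade g).support.sup fun p => p.2.natAbs, ?_⟩
    intro g hg p hp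
    exact (Finset.le_sup (f := fun p : ℕ × ℤ => p.2.natAbs) hp).trans
      (Finset.le_sup (f := fun g => (DirectSum.decompose T.grade g).support.sup
        fun p => p.2.natAbs) hg)
  set N : Submodule ℂ T.sectionRing :=
    ⨆ p : {p : ℕ × ℤ // -((c : ℤ) * p.1) ≤ p.2}, T.grade p.1 with hN
  have hmemN : ∀ (p : ℕ × ℤ) (s : T.sectionRing), -((c : ℤ) * p.1) ≤ p.2 → s ∈ T.grade p → s ∈ N :=
    fun p s hp hs => Submodule.mem_iSup_of_mem
      (⟨p, hp⟩ : {p : ℕ × ℤ // -((c : ℤ) * p.1) ≤ p.2}) hs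
  have hmul : ∀ a ∈ N, ∀ b ∈ N, a * b ∈ N := by
    intro a ha b hb
    induction ha using Submodule.iSup_induction' with
    | mem p a ha =>
      induction hb using Submodule.iSup_induction' with
      | mem q b hb =>
        refine hmemN (p.1 + q.1) _ ?_ (SetLike.mul_mem_graded ha hb)
        have := p.2
        have := q.2
        simp only [Prod.fst_add, Prod.snd_add]
        push_cast
        linarith
      | zero => simp
      | add b b' _ _ h h' => rw [mul_add]; exact N.add_mem h h'
    | zero => simp
    | add a a' _ _ h h' => rw [add_mul]; exact N.add_mem h h'
  have hpoly : ∀ p : Polynomial ℂ, algebraMap (Polynomial ℂ) T.sectionRing p ∈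
      ⨆ j : ℕ, T.grade (0, (j : ℤ)) := by
    intro p
    induction p using Polynomial.induction_on' with
    | add p q hp hq => rw [map_add]; exact Submodule.add_mem _ hp hq
    | monomial n a =>
      have : algebraMap (Polynomial ℂ) T.sectionRing (Polynomial.monomial n a) = a • t ^ n := by
        rw [← Polynomial.smul_X_eq_monomial, ht, ← map_pow,
          Algebra.algebraMap_eq_smul_one, Algebra.algebraMap_eq_smul_one, smul_assoc]
      rw [this]
      exact Submodule.mem_iSup_of_mem n (Submodule.smul_mem _ _ (hpow n))
  have hpolyN : ∀ p : Polynomial ℂ, algebraMap (Polynomial ℂ) T.sectionRing p ∈ N := fun p =>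
    (iSup_le fun j : ℕ => fun s hs => hmemN (0, (j : ℤ)) s (by simp) hs :
      (⨆ j : ℕ, T.grade (0, (j : ℤ))) ≤ N) (hpoly p)
  have hneg : ∀ i : ℤ, i < 0 → ∀ s ∈ T.grade (0, i), s = 0 := by
    intro i hi s hs
    obtain ⟨p, rfl⟩ := T.grade_zero i s hs
    rw [← DirectSum.decompose_of_mem_same T.grade hs]
    have hp := hpoly p
    generalize algebraMap (Polynomial ℂ) T.sectionRing p = x at hp
    induction hp using Submodule.iSup_induction' with
    | mem j x hx =>
      refine hproj (0, (j : ℤ)) (0, i) x hx fun h => ?_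
      have := congrArg Prod.snd h
      simp only at this
      omega
    | zero => simp
    | add x y _ _ h h' => rw [DirectSum.decompose_add, DirectSum.add_apply,
        Submodule.coe_add, h, h', add_zero]
  have htop : ∀ s : T.sectionRing, s ∈ N := by
    intro s
    have hs : s ∈ Algebra.adjoin (Polynomial ℂ) (G : Set T.sectionRing) := by rw [hG]; trivial
    induction hs using Algebra.adjoin_induction with
    | mem g hg =>
      rw [← DirectSum.sum_support_decompose T.grade g]
      refine Submodule.sum_mem _ fun p hp => ?_
      have hcp := hc g hg p hp
      have hm := (DirectSum.decompose T.grade g p).2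
      obtain ⟨k, i⟩ := p
      simp only at hcp
      rcases Nat.eq_zero_or_pos k with rfl | hk
      · rcases lt_or_ge i 0 with hi | hi
        · rw [hneg i hi _ hm]
          exact N.zero_mem
        · exact hmemN (0, i) _ (by simpa using hi) hm
      · refine hmemN (k, i) _ ?_ hm
        have h1 : (c : ℤ) * 1 ≤ c * k :=
          mul_le_mul_of_nonneg_left (by exact_mod_cast hk) (by positivity)
        simp only
        omega
    | algebraMap p => exact hpolyN p
    | add x y _ _ hx hy => exact N.add_mem hx hy
    | mul x y _ _ hx hy => exact hmul x hx y hy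
  refine ⟨c, fun k i hi => (Submodule.eq_bot_iff _).2 fun s hs => ?_⟩
  rw [← DirectSum.decompose_of_mem_same T.grade hs]
  have hsN := htop s
  clear hs
  induction hsN using Submodule.iSup_induction' with
  | mem p x hx =>
    refine hproj p.1 (k, i) x hx fun h => ?_
    have := p.2
    rw [h] at this
    simp only at this
    omega
  | zero => simp
  | add x y _ _ h h' => rw [DirectSum.decompose_add, DirectSum.add_apply,
      Submodule.coe_add, h, h', add_zero]

theorem exists_filt_bot (T : TestConfiguration.{u, v} X r) (m : ℕ) :
    ∃ i, T.filt m i = ⊥ := by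
  obtain ⟨c, hc⟩ := T.exists_weight_bound
  refine ⟨-(c * (m / r : ℕ)) - 1, ?_⟩
  rw [filt, hc _ _ (by omega), Submodule.map_bot]
  exact LinearMap.ker_eq_bot.2 (X.sec m).injective_subtype

/-- The weighted flag of `H⁰(X, Lᵐ)` given by the filtration of a test-configuration. -/
def flag (T : TestConfiguration.{u, v} X r) (m : ℕ) (hm : r ∣ m) : WeightedFlag (X.sec m) where
  toFun x := T.filt m ⌊x⌋
  mono x y h := T.filt_mono m (Int.floor_mono h)
  exists_bot := by
    obtain ⟨i, hi⟩ := T.exists_filt_bot m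
    exact ⟨i, by simpa using hi⟩
  exists_top := by
    obtain ⟨i, hi⟩ := T.exists_filt_top m hm
    exact ⟨i, by simpa using hi⟩
  right_cont x := by
    have h1 := Int.lt_floor_add_one x
    have h0 := Int.floor_le x
    refine (iInf₂_le ((x + (⌊x⌋ + 1)) / 2) (by linarith)).trans (le_of_eq ?_)
    congr 1
    rw [Int.floor_eq_iff]
    constructor <;> linarith

/-- The weighted flag of `H⁰(X, Lᵐ)ᵛ` given by the tensor power `(𝒳, ℒ^(m/r))`, a
test-configuration of exponent `m`. -/
def dualFlag (T : TestConfiguration.{u, v} X r) (m : ℕ) (hm : r ∣ m) :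
    WeightedFlag (Module.Dual ℂ (X.sec m)) := (T.flag m hm).dual

/-- The image of the class of `(𝒳, ℒ)` in the building `Δ_m` of `GL(H⁰(X, Lᵐ)ᵛ)`, i.e. the class
of `(𝒳, ℒ^(m/r))`. -/
def point (T : TestConfiguration.{u, v} X r) (m : ℕ) (hm : r ∣ m)
    (h : ¬ (T.dualFlag m hm).IsTrivial) : Building (Module.Dual ℂ (X.sec m)) :=
  Quotient.mk _ ⟨T.dualFlag m hm, h⟩

open Classical in
/-- The Tits distance `ρ_m` in `Δ_m` between the points defined by two test-configurations, `m` a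
multiple of both exponents (by convention `0` if one of the flags is trivial, so that
there is no such point). -/
def levelDist (T : TestConfiguration.{u, v} X r) (T' : TestConfiguration.{u, v} X r') (m : ℕ)
    (hm : r ∣ m) (hm' : r' ∣ m) : ℝ :=
  if h : ¬ (T.dualFlag m hm).IsTrivial ∧ ¬ (T'.dualFlag m hm').IsTrivial then
    Building.titsDist (T.point m hm h.1) (T'.point m hm' h.2)
  else 0

theorem dvd_left (r r' k : ℕ) : r ∣ k * (r * r') := ⟨k * r', by ring⟩

theorem dvd_right (r r' k : ℕ) : r' ∣ k * (r * r') := ⟨k * r, by ring⟩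

/-- The pseudo-metric `ρ = liminf_k ρ_{k r r'}`. -/
def rho (T : TestConfiguration.{u, v} X r) (T' : TestConfiguration.{u, v} X r') : ℝ :=
  liminf (fun k : ℕ => T.levelDist T' (k * (r * r')) (dvd_left r r' k) (dvd_right r r' k)) atTop

/-- The function `P̄(m) = Tr(A_m B_m) - w(m) w'(m) / h(m)` on `H⁰(X, Lᵐ)`. -/
def pBar (T : TestConfiguration.{u, v} X r) (T' : TestConfiguration.{u, v} X r') (m : ℕ)
    (hm : r ∣ m) (hm' : r' ∣ m) : ℝ :=
  (T.flag m hm).tracePairing (T'.flag m hm') - T.weight m * T'.weight m / X.hilbert m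

/-- The scalar product `⟨(𝒳, ℒ), (𝒳', ℒ')⟩ = limsup m⁻ⁿ⁻² P̄(m)`, over `m = k r r'` with
`k → ∞`. -/
def scalarProduct (T : TestConfiguration.{u, v} X r) (T' : TestConfiguration.{u, v} X r') : ℝ :=
  limsup (fun k : ℕ => T.pBar T' (k * (r * r')) (dvd_left r r' k) (dvd_right r r' k) /
    ((k * (r * r') : ℕ) : ℝ) ^ (X.dim + 2)) atTop

end TestConfiguration

end

/-! At a fixed level m the statement is linear algebra. Any two weighted flags have a common adapted
basis (`exists_adapted_inf`; two points of a building lie in one apartment). If a and c are the two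
weight vectors in such a basis and N = h(m), then Tr(AB) = ∑ aⱼcⱼ, w = -∑ aⱼ, d = ∑ aⱼ², and the
Killing form of gl is 2(N Tr(AB) - Tr A Tr B) = 2 `weightCov a c`. Hence P̄(m) = `weightCov a c` /
N, and the Tits distance is the arccosine of P̄(m) divided by the square roots of the two values of
`normSq` = d - w²/h. Dualising negates all weights, which leaves `weightCov` unchanged. The
generators chosen in the definitions do not matter: two generators of one flag differ by an
endomorphism that strictly lowers the flag, so has trace zero (`trace_eq_zero_of_lowers`).

The Killing form claim is therefore an equality at every level. For the distance, divide by mⁿ⁺²: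
once `normSq` / mⁿ⁺² is known to tend to the squared L² norm (`tendsto_normSq`), the decreasing
continuous function arccos turns the upper limit of P̄ into the lower limit of the angles
(`liminf_arccos_div`), with Cauchy–Schwarz supplying boundedness.

The bulk of the work is that convergence, since the norm is defined through limits that have to
exist. The graded pieces of the filtration have the dimensions of the bigraded pieces of S/tS, the
ring of the central fibre, and a Hilbert–Serre argument that keeps track of weights makes ∑ iᵉ dim
gr_i eventually polynomial in k (`eventuallyPoly_weightedDim_of_finset`). Its degree is at most n +
e because h(m) is O(mⁿ), by Noether normalisation (`exists_hilbert_bounds`), and the weights are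
O(m) (`exists_abs_weight_le`). The matching lower bound on h gives a₀ > 0. -/

noncomputable section

/-- Incomparability keeps chains of primes strict under contraction; lying over and going up lift
chains back. -/
theorem ringKrullDim_eq_of_finite_of_injective {R S : Type*} [CommRing R] [CommRing S]
    [Algebra R S] [Algebra.IsIntegral R S] [FaithfulSMul R S] :
    ringKrullDim S = ringKrullDim R := by
  apply le_antisymm
  · refine Order.krullDim_le_of_strictMono (PrimeSpectrum.comap (algebraMap R S)) fun I J h => ?_
    exact Ideal.IsIntegral.comap_lt_comap (R := R) (I := I.asIdeal) (J := J.asIdeal) h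
  · refine iSup_le fun l => ?_
    obtain ⟨P, hP, hPl⟩ := (Ideal.nonempty_primesOver (S := S) (RelSeries.head l).asIdeal).some
    have := hP
    have := hPl
    obtain ⟨L, hL, -⟩ := Ideal.exists_ltSeries_of_hasGoingUp l P
    rw [← hL]
    exact le_iSup (fun L : LTSeries (PrimeSpectrum S) => (L.length : WithBot ℕ∞)) L

/-- Bounding the degree in each variable separately, rather than the total degree, makes the
monomial count an exact power. -/
theorem finrank_restrictDegree (d N : ℕ) :
    finrank ℂ (MvPolynomial.restrictDegree (Fin d) ℂ N) = (N + 1) ^ d := by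
  rw [MvPolynomial.restrictDegree, finrank_eq_nat_card_basis (MvPolynomial.basisRestrictSupport ℂ _)]
  have e : {n : Fin d →₀ ℕ | ∀ i, n i ≤ N} ≃ (Fin d → Fin (N + 1)) :=
    { toFun := fun n i => ⟨n.1 i, Nat.lt_succ_of_le (n.2 i)⟩
      invFun := fun f => ⟨Finsupp.equivFunOnFinite.symm fun i => (f i : ℕ),
        fun i => Nat.lt_succ_iff.1 (f i).2⟩
      left_inv := fun n => by ext i; simp
      right_inv := fun f => by ext i; simp }
  rw [Nat.card_congr e]
  simp

instance finite_restrictDegree (d N : ℕ) :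
    FiniteDimensional ℂ (MvPolynomial.restrictDegree (Fin d) ℂ N) :=
  FiniteDimensional.of_finrank_pos (by rw [finrank_restrictDegree]; positivity)

theorem restrictDegree_mul_le (d N M : ℕ) : MvPolynomial.restrictDegree (Fin d) ℂ N *
    MvPolynomial.restrictDegree (Fin d) ℂ M ≤ MvPolynomial.restrictDegree (Fin d) ℂ (N + M) := by
  rw [MvPolynomial.restrictDegree, MvPolynomial.restrictDegree, ← MvPolynomial.restrictSupport_add]
  apply MvPolynomial.restrictSupport_mono
  rintro _ ⟨a, ha, b, hb, rfl⟩ i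
  exact add_le_add (ha i) (hb i)

theorem Submodule.FG.exists_le_of_le_iSup {R M : Type*} [Semiring R] [AddCommMonoid M] [Module R M]
    {W : Submodule R M} (hW : W.FG) {F : ℕ → Submodule R M} (hF : Monotone F)
    (h : W ≤ ⨆ m, F m) : ∃ m, W ≤ F m := by
  obtain ⟨s, hs⟩ := CompleteLattice.IsCompactElement.exists_finset_of_le_iSup _
    ((Submodule.fg_iff_compact W).1 hW) _ h
  obtain ⟨M, hM⟩ := s.exists_le
  exact ⟨M, hs.trans (iSup₂_le fun i hi => hF (hM i hi))⟩

namespace PolarisedVariety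

variable (X : PolarisedVariety.{u})

theorem sec_one_pow_le (m : ℕ) : X.sec 1 ^ m ≤ X.sec m := by
  induction m with
  | zero => rw [pow_zero, X.sec_zero]
  | succ m ih =>
    rw [pow_succ]
    refine (mul_le_mul' ih le_rfl).trans (Submodule.mul_le.2 fun a ha b hb => ?_)
    exact SetLike.mul_mem_graded ha hb

theorem mem_iSup_sec_one_pow (s : X.coordRing) : s ∈ ⨆ m, X.sec 1 ^ m := by
  have hs : s ∈ Algebra.adjoin ℂ (X.sec 1 : Set X.coordRing) := by
    rw [X.adjoin_sec_one]; trivial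
  induction hs using Algebra.adjoin_induction with
  | mem x hx => exact Submodule.mem_iSup_of_mem 1 (by rwa [pow_one])
  | algebraMap c =>
    refine Submodule.mem_iSup_of_mem 0 ?_
    rw [pow_zero]
    exact Submodule.algebraMap_mem c
  | add x y _ _ hx hy => exact Submodule.add_mem _ hx hy
  | mul x y _ _ hx hy =>
    have := Submodule.mul_mem_mul hx hy
    rw [Submodule.iSup_mul] at this
    refine (iSup_le fun i => ?_ : _ ≤ ⨆ m, X.sec 1 ^ m) this
    rw [Submodule.mul_iSup]
    refine iSup_le fun j => ?_
    rw [← pow_add]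
    exact le_iSup (fun m => X.sec 1 ^ m) (i + j)

/-- Since `R` is generated in degree one, s is a sum of elements of powers of `X.sec 1`; projecting
to degree m discards every power but the m-th. -/
theorem sec_eq_pow (m : ℕ) : X.sec m = X.sec 1 ^ m := by
  refine le_antisymm (fun s hs => ?_) (X.sec_one_pow_le m)
  rw [← DirectSum.decompose_of_mem_same X.sec hs]
  have := X.mem_iSup_sec_one_pow s
  clear hs
  induction this using Submodule.iSup_induction' with
  | mem j x hx =>
    by_cases h : j = m
    · subst h
      rwa [DirectSum.decompose_of_mem_same X.sec (X.sec_one_pow_le j hx)]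
    · rw [DirectSum.decompose_of_mem_ne X.sec (X.sec_one_pow_le j hx) h]
      exact zero_mem _
  | zero => simp
  | add x y _ _ h h' =>
    rw [DirectSum.decompose_add, DirectSum.add_apply, Submodule.coe_add]
    exact add_mem h h'

theorem sec_add (m k : ℕ) : X.sec (m + k) = X.sec m * X.sec k := by
  rw [X.sec_eq_pow (m + k), X.sec_eq_pow m, X.sec_eq_pow k, pow_add]

/-- Inhomogeneous elements of degree at most `m`. -/
def secLE (m : ℕ) : Submodule ℂ X.coordRing := (1 ⊔ X.sec 1) ^ m

theorem secLE_mono : Monotone X.secLE := monotone_nat_of_le_succ fun m => by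
  rw [secLE, secLE, pow_succ]
  calc (1 ⊔ X.sec 1) ^ m = (1 ⊔ X.sec 1) ^ m * 1 := (mul_one _).symm
    _ ≤ _ := mul_le_mul' le_rfl le_sup_left

theorem sec_le_secLE {k m : ℕ} (h : k ≤ m) : X.sec k ≤ X.secLE m := by
  refine le_trans ?_ (X.secLE_mono h)
  rw [sec_eq_pow]
  exact pow_le_pow_left' le_sup_right k

theorem secLE_le (m : ℕ) : X.secLE m ≤ ⨆ k : Fin (m + 1), X.sec k := by
  induction m with
  | zero =>
    rw [secLE, pow_zero, ← X.sec_zero]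
    exact le_iSup (fun k : Fin 1 => X.sec k) 0
  | succ m ih =>
    rw [secLE, pow_succ, ← secLE, Submodule.mul_sup, mul_one]
    refine sup_le (ih.trans ?_) ((mul_le_mul' ih le_rfl).trans ?_)
    · exact iSup_le fun k => le_iSup (fun k : Fin (m + 2) => X.sec k) k.castSucc
    · rw [Submodule.iSup_mul]
      refine iSup_le fun k => ?_
      rw [← X.sec_add]
      exact le_iSup (fun k : Fin (m + 2) => X.sec k) k.succ

theorem secLE_eq (m : ℕ) : X.secLE m = ⨆ k : Fin (m + 1), X.sec k :=
  le_antisymm (X.secLE_le m) (iSup_le fun k => X.sec_le_secLE (Nat.lt_succ_iff.1 k.2))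

theorem finrank_secLE (m : ℕ) :
    finrank ℂ (X.secLE m) = ∑ k : Fin (m + 1), finrank ℂ (X.sec k) := by
  have hind : iSupIndep fun k : Fin (m + 1) => X.sec k :=
    (DirectSum.Decomposition.isInternal X.sec).submodule_iSupIndep.comp Fin.val_injective
  rw [secLE_eq, ← Module.finrank_directSum]
  refine (LinearEquiv.finrank_eq ?_).symm
  refine (LinearEquiv.ofInjective _ hind.dfinsupp_lsum_injective).trans (LinearEquiv.ofEq _ _ ?_)
  rw [Submodule.iSup_eq_range_dfinsupp_lsum]

instance (m : ℕ) : FiniteDimensional ℂ (X.secLE m) := by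
  rw [secLE_eq]
  infer_instance

theorem exists_le_secLE {W : Submodule ℂ X.coordRing} (hW : W.FG) : ∃ m, W ≤ X.secLE m := by
  have hsup : W ≤ ⨆ m, X.secLE m := fun s _ =>
    (iSup_mono fun m => (X.sec_eq_pow m).symm.le.trans (X.sec_le_secLE le_rfl) :
      (⨆ m, X.sec 1 ^ m) ≤ _) (X.mem_iSup_sec_one_pow s)
  exact hW.exists_le_of_le_iSup X.secLE_mono hsup

instance finiteType_coordRing : Algebra.FiniteType ℂ X.coordRing := by
  obtain ⟨B, hB⟩ := (Submodule.fg_iff_finiteDimensional (X.sec 1)).2 inferInstance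
  refine ⟨⟨B, ?_⟩⟩
  rw [← Algebra.adjoin_span, hB, X.adjoin_sec_one]

/-- The image under `g : ℂ[y₁, …, y_d] → R` of the polynomials of degree at most `N` in each
variable. -/
def coeffLE {d : ℕ} (g : MvPolynomial (Fin d) ℂ →ₐ[ℂ] X.coordRing) (N : ℕ) :
    Submodule ℂ X.coordRing := (MvPolynomial.restrictDegree (Fin d) ℂ N).map g.toLinearMap

variable {X} {d : ℕ} (g : MvPolynomial (Fin d) ℂ →ₐ[ℂ] X.coordRing)

theorem coeffLE_mul_le (N M : ℕ) : X.coeffLE g N * X.coeffLE g M ≤ X.coeffLE g (N + M) := by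
  rw [coeffLE, coeffLE, ← Submodule.map_mul]
  exact Submodule.map_mono (restrictDegree_mul_le d N M)

theorem coeffLE_mono : Monotone (X.coeffLE g) := fun _ _ h =>
  Submodule.map_mono (MvPolynomial.restrictSupport_mono _ fun _ hn i => (hn i).trans h)

/-- The coefficients needed to express elements of `R` through module generators `E` have some
degree, so `R` is the increasing union of these spaces, and a finitely generated `W` already lies in
one of them. -/
theorem exists_le_coeffLE_mul {E : Finset X.coordRing}
    (hE : letI := g.toRingHom.toAlgebra
      Submodule.span (MvPolynomial (Fin d) ℂ) (E : Set X.coordRing) = ⊤)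
    {W : Submodule ℂ X.coordRing} (hW : W.FG) :
    ∃ N, W ≤ X.coeffLE g N * Submodule.span ℂ (E : Set X.coordRing) := by
  have hmono : Monotone fun N => X.coeffLE g N * Submodule.span ℂ (E : Set X.coordRing) :=
    fun _ _ h => mul_le_mul' (coeffLE_mono g h) le_rfl
  have hsup : W ≤ ⨆ N, X.coeffLE g N * Submodule.span ℂ (E : Set X.coordRing) := by
    intro s hsW
    clear hsW
    let _ := g.toRingHom.toAlgebra
    have hs : s ∈ Submodule.span (MvPolynomial (Fin d) ℂ) (E : Set X.coordRing) := by
      rw [hE]; trivial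
    induction hs using Submodule.span_induction with
    | mem x hx =>
      refine Submodule.mem_iSup_of_mem 0 ?_
      rw [← one_mul x]
      refine Submodule.mul_mem_mul ⟨1, ?_, map_one g⟩ (Submodule.subset_span hx)
      simp [MvPolynomial.mem_restrictDegree, MvPolynomial.support_one]
    | zero => exact zero_mem _
    | add x y _ _ hx hy => exact add_mem hx hy
    | smul a x _ hx =>
      have ha : g a ∈ ⨆ N, X.coeffLE g N := by
        refine Submodule.mem_iSup_of_mem a.totalDegree ⟨a, ?_, rfl⟩
        exact MvPolynomial.restrictTotalDegree_le_restrictDegree _ _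
          a.totalDegree
          ((MvPolynomial.mem_restrictTotalDegree _ _ _).2 le_rfl)
      have h := Submodule.mul_mem_mul ha hx
      rw [Submodule.iSup_mul] at h
      refine (iSup_le fun i => ?_ : _ ≤ ⨆ N, X.coeffLE g N * Submodule.span ℂ
        (E : Set X.coordRing)) h
      rw [Submodule.mul_iSup]
      refine iSup_le fun j => ?_
      rw [← mul_assoc]
      exact (mul_le_mul' (coeffLE_mul_le g i j) le_rfl).trans
        (le_iSup (fun N => X.coeffLE g N * Submodule.span ℂ (E : Set X.coordRing)) (i + j))
  exact hW.exists_le_of_le_iSup hmono hsup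

theorem finrank_coeffLE_mul_le (E : Finset X.coordRing) (N : ℕ) :
    finrank ℂ (X.coeffLE g N * Submodule.span ℂ (E : Set X.coordRing) :
      Submodule ℂ X.coordRing) ≤ E.card * (N + 1) ^ d := by
  have h₁ : FiniteDimensional ℂ (X.coeffLE g N) := (Submodule.fg_iff_finiteDimensional _).1
    (((Submodule.fg_iff_finiteDimensional _).2 inferInstance).map _)
  have h₂ : FiniteDimensional ℂ (Submodule.span ℂ (E : Set X.coordRing)) :=
    FiniteDimensional.span_finset ℂ E
  rw [← Submodule.mulMap_range]
  refine (LinearMap.finrank_range_le _).trans ?_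
  rw [Module.finrank_tensorProduct, mul_comm]
  refine Nat.mul_le_mul (finrank_span_finset_le_card E) ?_
  rw [← finrank_restrictDegree]
  exact Submodule.finrank_map_le _ _

/-- Multiplying `V = span E` by `U = 1 ⊔ R₁` raises the coefficient degree by a fixed amount D₂.
Iterating, `Uᵐ V` needs coefficients of degree at most D₂ m, and these form a space of dimension
O(mᵈ). -/
theorem finrank_secLE_le_of_finite (hg : g.Finite) :
    ∃ C : ℕ, ∀ m, finrank ℂ (X.secLE m) ≤ C * (m + 1) ^ d := by
  let _ := g.toRingHom.toAlgebra
  have hgf : Module.Finite (MvPolynomial (Fin d) ℂ) X.coordRing := hg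
  obtain ⟨E, hE⟩ : ∃ E : Finset X.coordRing,
    Submodule.span (MvPolynomial (Fin d) ℂ) (E : Set X.coordRing) = ⊤ := hgf.fg_top
  set U : Submodule ℂ X.coordRing := 1 ⊔ X.sec 1 with hU
  set V : Submodule ℂ X.coordRing := Submodule.span ℂ (E : Set X.coordRing) with hV
  have h1fg : (1 : Submodule ℂ X.coordRing).FG := ⟨{1}, by simp [Submodule.one_eq_span]⟩
  have hUfg : U.FG := h1fg.sup ((Submodule.fg_iff_finiteDimensional _).2 inferInstance)
  have hVfg : V.FG := ⟨E, rfl⟩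
  obtain ⟨D₁, hD₁⟩ := exists_le_coeffLE_mul g hE h1fg
  obtain ⟨D₂, hD₂⟩ := exists_le_coeffLE_mul g hE (hUfg.mul hVfg)
  have key : ∀ m, U ^ m * V ≤ X.coeffLE g (D₂ * m) * V := by
    intro m
    induction m with
    | zero =>
      rw [pow_zero]
      refine mul_le_mul' (Submodule.one_le.2 ⟨1, ?_, map_one g⟩) le_rfl
      simp [MvPolynomial.mem_restrictDegree, MvPolynomial.support_one]
    | succ m ih =>
      calc U ^ (m + 1) * V = U * (U ^ m * V) := by rw [pow_succ', mul_assoc]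
        _ ≤ U * (X.coeffLE g (D₂ * m) * V) := mul_le_mul' le_rfl ih
        _ = X.coeffLE g (D₂ * m) * (U * V) := mul_left_comm ..
        _ ≤ X.coeffLE g (D₂ * m) * (X.coeffLE g D₂ * V) := mul_le_mul' le_rfl hD₂
        _ ≤ X.coeffLE g (D₂ * (m + 1)) * V := by
          rw [← mul_assoc]
          exact mul_le_mul' (coeffLE_mul_le g _ _) le_rfl
  have key' : ∀ m, X.secLE m ≤ X.coeffLE g (D₁ + D₂ * m) * V := fun m =>
    calc X.secLE m = U ^ m * 1 := (mul_one _).symm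
      _ ≤ U ^ m * (X.coeffLE g D₁ * V) := mul_le_mul' le_rfl hD₁
      _ = X.coeffLE g D₁ * (U ^ m * V) := mul_left_comm ..
      _ ≤ X.coeffLE g D₁ * (X.coeffLE g (D₂ * m) * V) := mul_le_mul' le_rfl (key m)
      _ ≤ _ := by
        rw [← mul_assoc]
        exact mul_le_mul' (coeffLE_mul_le g _ _) le_rfl
  -- The constant comes from D₁ + D₂ m + 1 ≤ (D₁ + D₂ + 1)(m + 1).
  refine ⟨E.card * (D₁ + D₂ + 1) ^ d, fun m => ?_⟩
  have hfin : FiniteDimensional ℂ (X.coeffLE g (D₁ + D₂ * m) * V : Submodule ℂ X.coordRing) :=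
    (Submodule.fg_iff_finiteDimensional _).1
      ((((Submodule.fg_iff_finiteDimensional _).2 inferInstance).map _).mul hVfg)
  refine (Submodule.finrank_mono (key' m)).trans ((finrank_coeffLE_mul_le g E _).trans ?_)
  rw [mul_assoc, ← mul_pow]
  gcongr
  nlinarith

/-- If the images of the variables have degree at most c, a monomial with all exponents at most N is
sent into degree at most c d N, and the (N + 1)ᵈ such monomials stay independent. -/
theorem le_finrank_secLE_of_injective (hg : Function.Injective g) :
    ∃ c : ℕ, ∀ N, (N + 1) ^ d ≤ finrank ℂ (X.secLE (c * N)) := by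
  obtain ⟨c, hc⟩ := X.exists_le_secLE (W := Submodule.span ℂ (Set.range fun i => g (.X i)))
    (Submodule.fg_span (Set.finite_range _))
  refine ⟨c * d, fun N => ?_⟩
  have hprod : ∀ (n : Fin d →₀ ℕ) (s : Finset (Fin d)),
      ∏ i ∈ s, g (.X i) ^ n i ∈ X.secLE (c * ∑ i ∈ s, n i) := by
    intro n s
    induction s using Finset.induction_on with
    | empty => simp [secLE]
    | insert a s ha ih =>
      rw [Finset.prod_insert ha, Finset.sum_insert ha, mul_add, secLE, pow_add, pow_mul]
      exact Submodule.mul_mem_mul (Submodule.pow_mem_pow _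
        (hc (Submodule.subset_span ⟨a, rfl⟩)) _) ih
  have hle : X.coeffLE g N ≤ X.secLE (c * d * N) := by
    rw [coeffLE, MvPolynomial.restrictDegree, MvPolynomial.restrictSupport_eq_span,
      Submodule.map_span, Submodule.span_le]
    rintro _ ⟨_, ⟨n, hn, rfl⟩, rfl⟩
    have hsum : ∑ i, n i ≤ d * N := by
      simpa using Finset.sum_le_card_nsmul Finset.univ (fun i => n i) N fun i _ => hn i
    have := X.secLE_mono (Nat.mul_le_mul_left c hsum) (hprod n Finset.univ)
    rw [← mul_assoc] at this
    simpa [MvPolynomial.monomial_eq, Finsupp.prod_fintype] using this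
  rw [← finrank_restrictDegree]
  refine le_trans (le_of_eq ?_) (Submodule.finrank_mono hle)
  exact (LinearEquiv.finrank_eq (Submodule.equivMapOfInjective g.toLinearMap hg _))

variable (X) in
-- Noether normalisation provides a finite injective map from a polynomial ring; comparing Krull
-- dimensions forces the number of variables to be n + 1.
theorem exists_finrank_secLE_bounds : ∃ C c : ℕ,
    (∀ m, finrank ℂ (X.secLE m) ≤ C * (m + 1) ^ (X.dim + 1)) ∧
      ∀ N, (N + 1) ^ (X.dim + 1) ≤ finrank ℂ (X.secLE (c * N)) := by
  obtain ⟨d, g, hinj, hfin⟩ := exists_finite_inj_algHom_of_fg ℂ X.coordRing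
  have hd : d = X.dim + 1 := by
    let _ := g.toRingHom.toAlgebra
    have : Module.Finite (MvPolynomial (Fin d) ℂ) X.coordRing := hfin
    have : FaithfulSMul (MvPolynomial (Fin d) ℂ) X.coordRing :=
      (faithfulSMul_iff_algebraMap_injective _ _).2 hinj
    have h := ringKrullDim_eq_of_finite_of_injective (R := MvPolynomial (Fin d) ℂ)
      (S := X.coordRing)
    rw [X.ringKrullDim_eq, MvPolynomial.ringKrullDim_of_isNoetherianRing,
      ringKrullDim_eq_zero_of_field, zero_add, Nat.card_fin] at h
    exact_mod_cast h.symm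
  subst hd
  obtain ⟨C, hC⟩ := finrank_secLE_le_of_finite g hfin
  obtain ⟨c, hc⟩ := le_finrank_secLE_of_injective g hinj
  exact ⟨C, c, hC, hc⟩

variable (X) in
-- Multiplication by a nonzero section of degree one is injective because `R` is a domain.
theorem finrank_sec_mono : Monotone fun k => finrank ℂ (X.sec k) := by
  obtain ⟨x, hx, hx0⟩ : ∃ x ∈ X.sec 1, x ≠ 0 := by
    -- Without such a section `R` would be ℂ, while the lower bound at N = 1 asks for dimension at
    -- least 2ⁿ⁺¹.
    by_contra! h
    have h1 : X.sec 1 = ⊥ := (Submodule.eq_bot_iff _).2 h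
    have hR : ∀ m, X.secLE m = 1 := fun m => by
      rw [secLE, h1, sup_bot_eq, one_pow]
    obtain ⟨C, c, -, hc⟩ := X.exists_finrank_secLE_bounds
    have h2 := hc 1
    rw [hR, ← X.sec_zero] at h2
    have h3 : finrank ℂ (X.sec 0) ≤ 1 := by
      rw [X.sec_zero, Submodule.one_eq_span]
      exact (finrank_span_le_card _).trans (by simp)
    have h4 : 1 < (1 + 1) ^ (X.dim + 1) := Nat.one_lt_pow X.dim.succ_ne_zero (by norm_num)
    exact absurd (h2.trans h3) h4.not_ge
  refine monotone_nat_of_le_succ fun k => ?_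
  have hf : ∀ s ∈ X.sec k, LinearMap.mulRight ℂ x s ∈ X.sec (k + 1) := fun s hs =>
    SetLike.mul_mem_graded hs hx
  refine LinearMap.finrank_le_finrank_of_injective
    (f := (LinearMap.mulRight ℂ x).restrict hf) fun a b hab => ?_
  have := congrArg Subtype.val hab
  exact Subtype.ext (mul_right_cancel₀ hx0 (by simpa using this))

variable (X) in
/-- The Hilbert function grows exactly like `mⁿ`. -/
theorem exists_hilbert_bounds : ∃ C c : ℝ, 0 < c ∧
    (∀ m : ℕ, X.hilbert m ≤ C * ((m : ℝ) + 1) ^ X.dim) ∧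
      ∀ m : ℕ, c * (m : ℝ) ^ X.dim ≤ X.hilbert m := by
  obtain ⟨C, c, hC, hc⟩ := X.exists_finrank_secLE_bounds
  refine ⟨C * 2 ^ (X.dim + 1), 1 / ((c : ℝ) + 1) ^ (X.dim + 1), by positivity, fun m => ?_,
    fun m => ?_⟩
  -- By monotonicity each of the m + 1 degrees from m to 2m contributes at least h(m) to the
  -- dimension in degrees up to 2m.
  · have h1 : (m + 1) * finrank ℂ (X.sec m) ≤ C * (2 * m + 1) ^ (X.dim + 1) := by
      refine le_trans ?_ (hC (2 * m))
      rw [finrank_secLE, Fin.sum_univ_eq_sum_range fun k => finrank ℂ (X.sec k)]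
      calc (m + 1) * finrank ℂ (X.sec m) = ∑ k ∈ Finset.Ico m (2 * m + 1), finrank ℂ (X.sec m) := by
            simp; left; omega
        _ ≤ ∑ k ∈ Finset.Ico m (2 * m + 1), finrank ℂ (X.sec k) :=
            Finset.sum_le_sum fun k hk => X.finrank_sec_mono (Finset.mem_Ico.1 hk).1
        _ ≤ _ := Finset.sum_le_sum_of_subset fun k hk => by
            rw [Finset.mem_range]; exact (Finset.mem_Ico.1 hk).2
    have h2 : ((m : ℝ) + 1) * X.hilbert m ≤ C * (2 * m + 1) ^ (X.dim + 1) := by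
      rw [hilbert]; exact_mod_cast h1
    have hm : (0 : ℝ) < (m : ℝ) + 1 := by positivity
    refine le_of_mul_le_mul_left (h2.trans ?_) hm
    calc (C : ℝ) * (2 * m + 1) ^ (X.dim + 1) ≤ C * (2 * (m + 1)) ^ (X.dim + 1) := by
          gcongr; linarith
      _ = _ := by rw [mul_pow]; ring
  · have hpos : (0 : ℝ) < (c : ℝ) + 1 := by positivity
    -- The lower bound is applied with N = ⌊m/(c + 1)⌋, so that c N ≤ m; using c + 1 avoids dividing
    -- by zero. By monotonicity the dimension in degrees up to m is at most (m + 1) h(m).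
    have hN : m + 1 ≤ (c + 1) * (m / (c + 1) + 1) := Nat.lt_mul_div_succ m c.succ_pos
    have h1 : (m / (c + 1) + 1) ^ (X.dim + 1) ≤ (m + 1) * finrank ℂ (X.sec m) := by
      refine (hc _).trans ?_
      have hle : c * (m / (c + 1)) ≤ m :=
        (Nat.mul_le_mul_right _ c.le_succ).trans (Nat.mul_div_le m (c + 1))
      refine (Submodule.finrank_mono (X.secLE_mono hle)).trans ?_
      rw [finrank_secLE]
      refine (Finset.sum_le_card_nsmul _ _ (finrank ℂ (X.sec m)) fun k _ =>
        X.finrank_sec_mono (Nat.lt_succ_iff.1 k.2)).trans (by simp)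
    have h2 : ((m : ℝ) + 1) ^ (X.dim + 1) ≤
        ((c : ℝ) + 1) ^ (X.dim + 1) * (((m : ℝ) + 1) * X.hilbert m) := by
      have h3 := (Nat.pow_le_pow_left hN (X.dim + 1)).trans
        ((mul_pow _ _ _).le.trans (Nat.mul_le_mul_left _ h1))
      rw [hilbert]
      exact_mod_cast h3
    rw [div_mul_eq_mul_div, one_mul, div_le_iff₀ (by positivity)]
    have hm : (0 : ℝ) < (m : ℝ) + 1 := by positivity
    refine le_of_mul_le_mul_left (le_trans ?_ (h2.trans_eq (by ring))) hm
    rw [pow_succ']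
    gcongr
    linarith

end PolarisedVariety

/-! ### The Killing form of `gl(V)` -/

section KillingForm

variable {V : Type u} [AddCommGroup V] [Module ℂ V] [FiniteDimensional ℂ V]

/-- Under End V ≅ Vᵛ ⊗ V the map C ↦ ACB is Bᵗ ⊗ A, and the trace of a tensor product is the product
of the traces. -/
theorem trace_mulLeft_comp_mulRight (A B : Module.End ℂ V) :
    LinearMap.trace ℂ _ (LinearMap.mulLeft ℂ A ∘ₗ LinearMap.mulRight ℂ B) =
      LinearMap.trace ℂ V A * LinearMap.trace ℂ V B := by
  set e := dualTensorHomEquivOfBasis (N := V) (Module.finBasis ℂ V) with he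
  have h : LinearMap.mulLeft ℂ A ∘ₗ LinearMap.mulRight ℂ B =
      e.conj (TensorProduct.map (Module.Dual.transpose (R := ℂ) B) A) := by
    have h' : (LinearMap.mulLeft ℂ A ∘ₗ LinearMap.mulRight ℂ B) ∘ₗ e.toLinearMap =
        e.toLinearMap ∘ₗ TensorProduct.map (Module.Dual.transpose (R := ℂ) B) A := by
      ext f v w
      simp [he, Module.Dual.transpose_apply]
    ext1 x
    obtain ⟨y, rfl⟩ := e.surjective x
    rw [LinearEquiv.conj_apply_apply, LinearEquiv.symm_apply_apply]
    exact LinearMap.congr_fun h' y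
  rw [h, LinearMap.trace_conj', LinearMap.trace_tensorProduct', LinearMap.trace_transpose', mul_comm]

/-- Expanding ad A ∘ ad B gives C ↦ ABC - ACB - BCA + CBA; the outer terms each have trace N Tr(AB),
the inner ones Tr A Tr B. -/
theorem glKillingForm_apply (A B : Module.End ℂ V) : glKillingForm V A B =
    2 * (finrank ℂ V * LinearMap.trace ℂ V (A * B) -
      LinearMap.trace ℂ V A * LinearMap.trace ℂ V B) := by
  let _ : LieRing (Module.End ℂ V) := LieRing.ofAssociativeRing
  have h : LieAlgebra.ad ℂ (Module.End ℂ V) A ∘ₗ LieAlgebra.ad ℂ (Module.End ℂ V) B =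
      LinearMap.mulLeft ℂ (A * B) ∘ₗ LinearMap.mulRight ℂ 1 -
      LinearMap.mulLeft ℂ A ∘ₗ LinearMap.mulRight ℂ B -
      LinearMap.mulLeft ℂ B ∘ₗ LinearMap.mulRight ℂ A +
      LinearMap.mulLeft ℂ 1 ∘ₗ LinearMap.mulRight ℂ (B * A) := by
    ext1 C
    simp only [LinearMap.comp_apply, LieAlgebra.ad_apply, Ring.lie_def, LinearMap.sub_apply,
      LinearMap.add_apply, LinearMap.mulLeft_apply, LinearMap.mulRight_apply]
    noncomm_ring
  have h' : glKillingForm V A B = LinearMap.trace ℂ _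
    (LieAlgebra.ad ℂ (Module.End ℂ V) A ∘ₗ LieAlgebra.ad ℂ (Module.End ℂ V) B) := rfl
  rw [h', h, map_add, map_sub, map_sub]
  simp only [trace_mulLeft_comp_mulRight, LinearMap.trace_one]
  rw [LinearMap.trace_mul_comm ℂ B A]
  ring

end KillingForm

namespace WeightedFlag

section

variable {V : Type u} [AddCommGroup V] [Module ℂ V] {F : WeightedFlag V} {A A' B : Module.End ℂ V}

/-- A acts as the scalar x on F_x modulo the strictly lower steps: A - x kills eigenvectors of
eigenvalue x and preserves the lower eigenspaces. Only finitely many eigenvectors occur in v, so a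
single y < x suffices. -/
theorem IsGenerator.exists_sub_smul_mem (hA : F.IsGenerator A) {x : ℝ} {v : V}
    (hv : v ∈ F.toFun x) : ∃ y < x, A v - (x : ℂ) • v ∈ F.toFun y := by
  rw [hA] at hv
  induction hv using Submodule.iSup_induction' with
  | mem y v hv =>
    rw [Submodule.mem_iSup] at hv
    by_cases hyx : y ≤ x
    · have hv' : v ∈ A.eigenspace (y : ℂ) := by
        simpa [hyx] using (Submodule.mem_iSup _).2 hv
      rw [Module.End.mem_eigenspace_iff] at hv'
      rcases hyx.lt_or_eq with h | rfl
      · refine ⟨y, h, ?_⟩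
        rw [hv', ← sub_smul, hA]
        refine Submodule.smul_mem _ _ (Submodule.mem_iSup_of_mem y ?_)
        simpa [Module.End.mem_eigenspace_iff] using hv'
      · exact ⟨y - 1, by linarith, by simp [hv']⟩
    · have : v = 0 := by simpa [hyx] using (Submodule.mem_iSup _).2 hv
      exact ⟨x - 1, by linarith, by simp [this]⟩
  | zero => exact ⟨x - 1, by linarith, by simp⟩
  | add v w _ _ hv hw =>
    obtain ⟨y, hy, hy'⟩ := hv
    obtain ⟨z, hz, hz'⟩ := hw
    refine ⟨max y z, max_lt hy hz, ?_⟩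
    have := add_mem (F.mono (le_max_left y z) hy') (F.mono (le_max_right y z) hz')
    rwa [map_add, smul_add, add_sub_add_comm]

/-- Both generators act by the same scalar on each graded piece, so their difference strictly lowers
the flag. -/
theorem IsGenerator.exists_sub_mem (hA : F.IsGenerator A) (hA' : F.IsGenerator A') {x : ℝ} {v : V}
    (hv : v ∈ F.toFun x) : ∃ y < x, (A - A') v ∈ F.toFun y := by
  obtain ⟨y, hy, hy'⟩ := hA.exists_sub_smul_mem hv
  obtain ⟨z, hz, hz'⟩ := hA'.exists_sub_smul_mem hv
  refine ⟨max y z, max_lt hy hz, ?_⟩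
  have := sub_mem (F.mono (le_max_left y z) hy') (F.mono (le_max_right y z) hz')
  rwa [sub_sub_sub_cancel_right] at this

theorem IsGenerator.mem_of_commute (hA : F.IsGenerator A) (h : Commute A B) {x : ℝ} {v : V}
    (hv : v ∈ F.toFun x) : B v ∈ F.toFun x := by
  rw [hA] at hv ⊢
  suffices h' : (⨆ y : ℝ, ⨆ _ : y ≤ x, A.eigenspace (y : ℂ)) ≤
      Submodule.comap B (⨆ y : ℝ, ⨆ _ : y ≤ x, A.eigenspace (y : ℂ)) from h' hv
  refine iSup₂_le fun y hy w hw => ?_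
  refine Submodule.mem_iSup_of_mem y (Submodule.mem_iSup_of_mem hy ?_)
  rw [Module.End.mem_eigenspace_iff] at hw ⊢
  rw [← Module.End.mul_apply, h.eq, Module.End.mul_apply, hw, map_smul]

end

variable {V : Type u} [AddCommGroup V] [Module ℂ V] [FiniteDimensional ℂ V]

/-- By the descending chain condition the right limit of the filtration is attained, and right
continuity identifies it with F_x. -/
theorem exists_le_right (F : WeightedFlag V) (x : ℝ) : ∃ y, x < y ∧ F.toFun y ≤ F.toFun x := by
  obtain ⟨_, ⟨⟨y, hy, rfl⟩, hmin⟩⟩ := WellFounded.has_min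
    (wellFounded_lt (α := Submodule ℂ V)) (F.toFun '' Set.Ioi x) ⟨_, x + 1, by simp, rfl⟩
  refine ⟨y, hy, le_trans ?_ (F.right_cont x)⟩
  simp only [le_iInf_iff]
  intro z hz
  rcases le_total y z with h | h
  · exact F.mono h
  · exact ((F.mono h).eq_of_not_lt (hmin _ ⟨z, hz, rfl⟩)).ge

/-- The ascending chain condition makes the union of the steps below x one of them. -/
theorem exists_ge_left (F : WeightedFlag V) (x : ℝ) :
    ∃ y, y < x ∧ ∀ z < x, F.toFun z ≤ F.toFun y := by
  obtain ⟨_, ⟨⟨y, hy, rfl⟩, hmin⟩⟩ := WellFounded.has_min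
    (wellFounded_gt (α := Submodule ℂ V)) (F.toFun '' Set.Iio x) ⟨_, x - 1, by simp, rfl⟩
  refine ⟨y, hy, fun z hz => ?_⟩
  rcases le_total z y with h | h
  · exact F.mono h
  · exact ((F.mono h).eq_of_not_lt (hmin _ ⟨z, hz, rfl⟩)).ge

/-- A property that passes to larger subspaces is first attained at some weight. -/
theorem exists_first (F : WeightedFlag V) {Q : Submodule ℂ V → Prop}
    (hQ : ∀ U U', U ≤ U' → Q U → Q U') (htop : Q ⊤) (hbot : ¬ Q ⊥) :
    ∃ x, Q (F.toFun x) ∧ ∀ y < x, ¬ Q (F.toFun y) := by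
  obtain ⟨t, ht⟩ := F.exists_top
  obtain ⟨z, hz⟩ := F.exists_bot
  have hne : {x | Q (F.toFun x)}.Nonempty := ⟨t, by simpa [ht] using htop⟩
  have hbdd : BddBelow {x | Q (F.toFun x)} := ⟨z, fun x hx => by
    by_contra! h
    exact hbot (hz ▸ hQ _ _ (F.mono h.le) hx)⟩
  refine ⟨sInf {x | Q (F.toFun x)}, ?_, fun y hy h => (csInf_le hbdd h).not_gt hy⟩
  obtain ⟨y, hy, hyx⟩ := F.exists_le_right (sInf {x | Q (F.toFun x)})
  obtain ⟨s, hs, hsy⟩ := exists_lt_of_csInf_lt hne hy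
  exact hQ _ _ ((F.mono hsy.le).trans hyx) hs

/-! #### Uniqueness of the trace pairing -/

/-- An eigenvector with nonzero eigenvalue would be moved below the first step that contains it, so
all eigenvalues vanish. -/
theorem trace_eq_zero_of_lowers (F : WeightedFlag V) (N : Module.End ℂ V)
    (h : ∀ x, ∀ v ∈ F.toFun x, ∃ y < x, N v ∈ F.toFun y) : LinearMap.trace ℂ V N = 0 := by
  rw [Module.End.trace_eq_sum_roots_charpoly_of_splits (IsAlgClosed.splits _)]
  refine Multiset.sum_eq_zero fun μ hμ => ?_
  have hroot := (Polynomial.mem_roots'.1 hμ).2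
  rw [← Module.End.hasEigenvalue_iff_isRoot_charpoly] at hroot
  obtain ⟨v, hv⟩ := Module.End.HasEigenvalue.exists_hasEigenvector hroot
  by_contra hμ0
  obtain ⟨x, hx, hmin⟩ := F.exists_first (Q := fun U => v ∈ U) (fun U U' h hv => h hv) trivial
    (by simpa using hv.2)
  obtain ⟨y, hy, hNv⟩ := h x v hx
  rw [hv.apply_eq_smul] at hNv
  exact hmin y hy ((Submodule.smul_mem_iff _ hμ0).1 hNv)

variable {F G : WeightedFlag V} {A A' B B' : Module.End ℂ V}


theorem IsGenerator.trace_eq (hA : F.IsGenerator A) (hA' : F.IsGenerator A') :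
    LinearMap.trace ℂ V A = LinearMap.trace ℂ V A' := by
  rw [← sub_eq_zero, ← map_sub]
  exact F.trace_eq_zero_of_lowers _ fun x v hv => hA.exists_sub_mem hA' hv

/-- The generators are exchanged one at a time. B commutes with A, so preserves F, and (A - A')B
strictly lowers F; likewise A' preserves G, and (B - B')A' strictly lowers G. -/
theorem IsGenerator.trace_mul_eq (hA : F.IsGenerator A) (hB : G.IsGenerator B)
    (hA' : F.IsGenerator A') (hB' : G.IsGenerator B') (h : Commute A B) (h' : Commute A' B') :
    LinearMap.trace ℂ V (A * B) = LinearMap.trace ℂ V (A' * B') := by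
  have h1 : LinearMap.trace ℂ V ((A - A') * B) = 0 :=
    F.trace_eq_zero_of_lowers _ fun x v hv => hA.exists_sub_mem hA' (hA.mem_of_commute h hv)
  have h2 : LinearMap.trace ℂ V ((B - B') * A') = 0 :=
    G.trace_eq_zero_of_lowers _ fun x v hv =>
      hB.exists_sub_mem hB' (hB'.mem_of_commute h'.symm hv)
  rw [LinearMap.trace_mul_comm, mul_sub, map_sub, sub_eq_zero] at h2
  rw [sub_mul, map_sub, sub_eq_zero] at h1
  rw [h1, h2]

/-! #### Bases adapted to two flags -/

/-- A basis (or linearly independent family) `b` with weights `a` spanning the flag `F`. -/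
def Adapted {ι : Type} (F : WeightedFlag V) (b : ι → V) (a : ι → ℝ) : Prop :=
  ∀ x, F.toFun x = Submodule.span ℂ (b '' {j | a j ≤ x})

/-- Induction on W. Let x₀ be the first F-weight at which all of W is reached, and H a hyperplane of
W containing the earlier part of W. A basis of H is completed by a vector e of W outside H of least
G-weight y₀. Below x₀ (respectively y₀) the steps of F (respectively G) meet W inside H, so e
receives the weights x₀ and y₀. -/
theorem exists_adapted_inf (F G : WeightedFlag V) (W : Submodule ℂ V) :
    ∃ (ι : Type) (_ : Fintype ι) (b : ι → V) (a c : ι → ℝ), LinearIndependent ℂ b ∧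
      (∀ x, F.toFun x ⊓ W = Submodule.span ℂ (b '' {j | a j ≤ x})) ∧
      ∀ x, G.toFun x ⊓ W = Submodule.span ℂ (b '' {j | c j ≤ x}) := by
  induction W using WellFoundedLT.induction with
  | ind W ih =>
  by_cases hW : W = ⊥
  · subst hW
    refine ⟨Empty, inferInstance, Empty.elim, Empty.elim, Empty.elim,
      linearIndependent_empty_type, fun x => ?_, fun x => ?_⟩ <;>
      simp [Set.eq_empty_of_isEmpty]
  obtain ⟨x₀, hx₀, hx₀min⟩ := F.exists_first (Q := fun U => W ≤ U) (fun U U' h hU => hU.trans h)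
    le_top (by simpa using hW)
  obtain ⟨x₁, hx₁, hx₁max⟩ := F.exists_ge_left x₀
  obtain ⟨H, ⟨hH1, hHW⟩, hHmax⟩ := WellFounded.has_min (wellFounded_gt (α := Submodule ℂ V))
    {H | F.toFun x₁ ⊓ W ≤ H ∧ H < W}
    ⟨_, le_rfl, lt_of_le_of_ne inf_le_right fun h => hx₀min x₁ hx₁ (inf_eq_right.1 h)⟩
  obtain ⟨ι, _, b, a, c, hb, hF, hG⟩ := ih H hHW
  obtain ⟨y₀, hy₀, hy₀min⟩ := G.exists_first (Q := fun U => ¬ U ⊓ W ≤ H)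
    (fun U U' h hU hU' => hU ((inf_le_inf_right W h).trans hU')) (by simpa using hHW.not_ge)
    (by simp)
  obtain ⟨e, ⟨heG, heW⟩, heH⟩ := SetLike.not_le_iff_exists.1 hy₀
  have hsup : H ⊔ Submodule.span ℂ {e} = W := by
    have hle : H ⊔ Submodule.span ℂ {e} ≤ W :=
      sup_le hHW.le ((Submodule.span_singleton_le_iff_mem _ _).2 heW)
    by_contra hne
    refine hHmax _ ⟨hH1.trans le_sup_left, lt_of_le_of_ne hle hne⟩ (lt_of_le_of_ne le_sup_left ?_)
    intro h
    exact heH (h ▸ Submodule.mem_sup_right (Submodule.mem_span_singleton_self e))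
  have himage : ∀ (w : ι → ℝ) (w₀ x : ℝ), Submodule.span ℂ
      ((fun j : Option ι => j.elim e b) '' {j | j.elim w₀ w ≤ x}) =
      Submodule.span ℂ (b '' {j | w j ≤ x}) ⊔ if w₀ ≤ x then Submodule.span ℂ {e} else ⊥ := by
    intro w w₀ x
    have : (fun j : Option ι => j.elim e b) '' {j | j.elim w₀ w ≤ x} =
        b '' {j | w j ≤ x} ∪ if w₀ ≤ x then {e} else ∅ := by
      ext v
      split_ifs with h <;> simp [Option.exists, h, eq_comm]
    rw [this, Submodule.span_union]
    split_ifs <;> simp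
  refine ⟨Option ι, inferInstance, fun j => j.elim e b, fun j => j.elim x₀ a, fun j => j.elim y₀ c,
    ?_, fun x => ?_, fun y => ?_⟩
  · refine linearIndependent_option.2 ⟨hb, fun h => heH ?_⟩
    refine (Submodule.span_le.2 ?_ : _ ≤ H) h
    rintro _ ⟨j, rfl⟩
    have : b j ∈ F.toFun (a j) ⊓ H := by
      rw [hF]
      exact Submodule.subset_span ⟨j, le_refl (a j), rfl⟩
    exact this.2
  · rw [himage, ← hF]
    split_ifs with h
    · have hWF : W ≤ F.toFun x := hx₀.trans (F.mono h)
      rw [inf_eq_right.2 hWF, inf_eq_right.2 (hHW.le.trans hWF), hsup]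
    · rw [sup_bot_eq]
      refine le_antisymm (le_inf inf_le_left ?_) (inf_le_inf_left _ hHW.le)
      exact (inf_le_inf_right W (hx₁max x (not_le.1 h))).trans hH1
  · rw [himage, ← hG]
    split_ifs with h
    · have he : Submodule.span ℂ {e} ≤ G.toFun y :=
        (Submodule.span_singleton_le_iff_mem _ _).2 (G.mono h heG)
      -- Modular law, with e in G_y.
      rw [← hsup, inf_sup_assoc_of_le _ he]
    · rw [sup_bot_eq]
      refine le_antisymm (le_inf inf_le_left ?_) (inf_le_inf_left _ hHW.le)
      exact not_not.1 (hy₀min y (not_le.1 h))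

theorem exists_adapted (F G : WeightedFlag V) :
    ∃ (ι : Type) (_ : Fintype ι) (b : Basis ι ℂ V) (a c : ι → ℝ), F.Adapted b a ∧ G.Adapted b c := by
  obtain ⟨ι, hι, b, a, c, hb, hF, hG⟩ := exists_adapted_inf F G ⊤
  simp only [inf_top_eq] at hF hG
  obtain ⟨x, hx⟩ := F.exists_top
  have hspan : ⊤ ≤ Submodule.span ℂ (Set.range b) := by
    rw [← hx, hF]
    exact Submodule.span_mono (Set.image_subset_range _ _)
  exact ⟨ι, hι, Basis.mk hb hspan, a, c, by simpa [Adapted] using hF, by simpa [Adapted] using hG⟩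

end WeightedFlag

/-- The endomorphism with eigenbasis `b` and real eigenvalues `a`. -/
def diagEnd {V : Type u} [AddCommGroup V] [Module ℂ V] {ι : Type} [Fintype ι]
    (b : Basis ι ℂ V) (a : ι → ℝ) : Module.End ℂ V :=
  open Classical in Matrix.toLinAlgEquiv b (Matrix.diagonal fun j => (a j : ℂ))

/-- `N ∑ aⱼ cⱼ - (∑ aⱼ) (∑ cⱼ)`: half the Killing form of the diagonal matrices with entries `a`
and `c`. -/
def weightCov {ι : Type} [Fintype ι] (a c : ι → ℝ) : ℝ :=
  Fintype.card ι * ∑ j, a j * c j - (∑ j, a j) * ∑ j, c j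

section diagEnd

variable {V : Type u} [AddCommGroup V] [Module ℂ V] {ι : Type} [Fintype ι] (b : Basis ι ℂ V)
  (a c : ι → ℝ)

theorem diagEnd_apply_self (j : ι) : diagEnd b a (b j) = (a j : ℂ) • b j := by
  classical
  rw [diagEnd, Matrix.toLinAlgEquiv_self]
  simp [Matrix.diagonal_apply]

theorem commute_diagEnd : Commute (diagEnd b a) (diagEnd b c) := by
  classical
  rw [Commute, SemiconjBy, diagEnd, diagEnd, ← map_mul, ← map_mul, Matrix.diagonal_mul_diagonal,
    Matrix.diagonal_mul_diagonal]
  simp_rw [mul_comm]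

theorem trace_diagEnd : LinearMap.trace ℂ V (diagEnd b a) = ((∑ j, a j : ℝ) : ℂ) := by
  classical
  refine (Matrix.trace_toLin_eq _ b).trans ?_
  simp [Matrix.trace_diagonal]

theorem trace_diagEnd_mul :
    LinearMap.trace ℂ V (diagEnd b a * diagEnd b c) = ((∑ j, a j * c j : ℝ) : ℂ) := by
  have : diagEnd b a * diagEnd b c = diagEnd b fun j => a j * c j := by
    classical
    rw [diagEnd, diagEnd, ← map_mul, Matrix.diagonal_mul_diagonal, diagEnd]
    simp
  rw [this, trace_diagEnd]

theorem glKillingForm_diagEnd :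
    glKillingForm V (diagEnd b a) (diagEnd b c) = ((2 * weightCov a c : ℝ) : ℂ) := by
  have : FiniteDimensional ℂ V := b.finiteDimensional_of_finite
  rw [glKillingForm_apply, trace_diagEnd_mul, trace_diagEnd, trace_diagEnd,
    Module.finrank_eq_card_basis b, weightCov]
  push_cast
  ring

/-- Shifting weights adds scalars to the generators, and scalars lie in the kernel of the Killing
form. -/
theorem weightCov_shift (s t : ℝ) :
    weightCov (fun j => a j - s) (fun j => c j - t) = weightCov a c := by
  simp only [weightCov, sub_mul, mul_sub, Finset.sum_sub_distrib, ← Finset.sum_mul,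
    ← Finset.mul_sum, Finset.sum_const, Finset.card_univ, nsmul_eq_mul]
  ring

theorem weightCov_neg : weightCov (fun j => -a j) (fun j => -c j) = weightCov a c := by
  simp [weightCov]

theorem weightCov_const_left (s : ℝ) : weightCov (fun _ => s) c = 0 := by
  simp [weightCov, ← Finset.mul_sum]
  ring

/-- After subtracting the means, `weightCov` is N times the Euclidean product, so this is
Cauchy–Schwarz. -/
theorem weightCov_sq_le : weightCov a c ^ 2 ≤ weightCov a a * weightCov c c := by
  rcases isEmpty_or_nonempty ι with h | h
  · simp [weightCov]
  have hN : (0 : ℝ) < Fintype.card ι := by exact_mod_cast Fintype.card_pos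
  have hcs := Finset.sum_mul_sq_le_sq_mul_sq Finset.univ
    (fun j => a j - (∑ i, a i) / Fintype.card ι) (fun j => c j - (∑ i, c i) / Fintype.card ι)
  have hsum : ∀ x : ι → ℝ, ∑ j, (x j - (∑ i, x i) / Fintype.card ι) = 0 := fun x => by
    rw [Finset.sum_sub_distrib, Finset.sum_const, Finset.card_univ, nsmul_eq_mul,
      mul_div_cancel₀ _ hN.ne', sub_self]
  have key : ∀ x y : ι → ℝ, weightCov x y = Fintype.card ι *
      ∑ j, (x j - (∑ i, x i) / Fintype.card ι) * (y j - (∑ i, y i) / Fintype.card ι) := fun x y => by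
    rw [← weightCov_shift x y ((∑ i, x i) / Fintype.card ι) ((∑ i, y i) / Fintype.card ι),
      weightCov, hsum, zero_mul, sub_zero]
  rw [key a c, key a a, key c c]
  simp only [← sq]
  calc _ = (Fintype.card ι : ℝ) ^ 2 * (∑ j, (a j - (∑ i, a i) / Fintype.card ι) *
        (c j - (∑ i, c i) / Fintype.card ι)) ^ 2 := mul_pow _ _ _
    _ ≤ _ := mul_le_mul_of_nonneg_left hcs (by positivity)
    _ = _ := by ring

end diagEnd

namespace WeightedFlag

section

variable {V : Type u} [AddCommGroup V] [Module ℂ V] {ι : Type} {b : Basis ι ℂ V}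
  {a : ι → ℝ} {F : WeightedFlag V}

theorem Adapted.weight_eq (h : F.Adapted b a) (ht : F.IsTrivial) (i j : ι) : a i = a j := by
  have key : ∀ i j, a i ≤ a j := by
    intro i j
    have hj : b j ∈ F.toFun (a j) := by
      rw [h]
      exact Submodule.subset_span ⟨j, le_refl (a j), rfl⟩
    rcases ht (a j) with h0 | h0
    · rw [h0, Submodule.mem_bot] at hj
      exact absurd hj (b.ne_zero j)
    · have hi : b i ∈ F.toFun (a j) := by rw [h0]; trivial
      rw [h, Basis.mem_span_image, b.repr_self] at hi
      exact hi (by simp)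
  exact le_antisymm (key i j) (key j i)

/-- The flag with all weights lowered by `s`. -/
def shift (F : WeightedFlag V) (s : ℝ) : WeightedFlag V where
  toFun x := F.toFun (x + s)
  mono x y h := F.mono (by linarith)
  exists_bot := by
    obtain ⟨x, hx⟩ := F.exists_bot
    exact ⟨x - s, by simpa using hx⟩
  exists_top := by
    obtain ⟨x, hx⟩ := F.exists_top
    exact ⟨x - s, by simpa using hx⟩
  right_cont x := by
    refine le_trans ?_ (F.right_cont (x + s))
    simp only [le_iInf_iff]
    intro y hy
    exact (iInf₂_le (y - s) (by linarith)).trans (by simp)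

theorem Adapted.shift (h : F.Adapted b a) (s : ℝ) : (F.shift s).Adapted b fun j => a j - s := by
  intro x
  simp only [WeightedFlag.shift, h (x + s), sub_le_iff_le_add]

theorem not_isTrivial_shift (h : ¬ F.IsTrivial) (s : ℝ) : ¬ (F.shift s).IsTrivial := by
  intro ht
  refine h fun x => ?_
  simpa [WeightedFlag.shift] using ht (x - s)

theorem Adapted.of_rel {F' : WeightedFlag V} {k s : ℝ} (hk : 0 < k)
    (h : ∀ x, F'.toFun (k * x + s) = F.toFun x) (hF : F.Adapted b a) :
    F'.Adapted b fun j => k * a j + s := by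
  intro x
  have hx : x = k * ((x - s) / k) + s := by field_simp; ring
  rw [hx, h, hF]
  congr 2
  ext j
  simp only [Set.mem_ofPred_eq]
  rw [← hx, le_div_iff₀ hk]
  constructor <;> intro <;> linarith

end

variable {V : Type u} [AddCommGroup V] [Module ℂ V] {ι : Type} [Fintype ι] {b : Basis ι ℂ V}
  {a c : ι → ℝ} {F G : WeightedFlag V}

theorem Adapted.isGenerator (h : F.Adapted b a) : F.IsGenerator (diagEnd b a) := by
  intro x
  rw [h]
  apply le_antisymm
  · rw [Submodule.span_le]
    rintro _ ⟨j, hj, rfl⟩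
    refine Submodule.mem_iSup_of_mem (a j) (Submodule.mem_iSup_of_mem hj ?_)
    rw [Module.End.mem_eigenspace_iff, diagEnd_apply_self]
  · refine iSup₂_le fun y hy v hv => ?_
    rw [Basis.mem_span_image]
    intro j hj
    rw [Module.End.mem_eigenspace_iff] at hv
    -- An eigenvector of eigenvalue y only involves basis vectors of weight y: comparing j-th
    -- coordinates gives y vⱼ = aⱼ vⱼ.
    have h1 : b.repr (diagEnd b a v) j = a j * b.repr v j := by
      have h0 : b.coord j ∘ₗ diagEnd b a = (a j : ℂ) • b.coord j := by
        classical
        refine b.ext fun i => ?_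
        by_cases hij : i = j
        · simp [diagEnd_apply_self, hij]
        · simp [diagEnd_apply_self, hij]
      exact LinearMap.congr_fun h0 v
    rw [hv] at h1
    have h2 : b.repr v j ≠ 0 := Finsupp.mem_support_iff.1 hj
    have h3 : (y : ℂ) = a j := by
      apply mul_right_cancel₀ h2
      rw [← h1, map_smul, Finsupp.smul_apply, smul_eq_mul]
    have h4 : y = a j := by exact_mod_cast h3
    show a j ≤ x
    rwa [← h4]

/-- A functional lies in the dual step at x when it kills every bⱼ with aⱼ < -x, that is, when it
only involves dual basis vectors with -aⱼ ≤ x. -/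
theorem Adapted.dual [DecidableEq ι] (h : F.Adapted b a) : F.dual.Adapted b.dualBasis fun j => -a j := by
  intro x
  ext f
  rw [Basis.mem_span_image]
  simp only [WeightedFlag.dual, Submodule.mem_iInf]
  have hmem : ∀ y, f ∈ (F.toFun y).dualAnnihilator ↔ ∀ j, a j ≤ y → f (b j) = 0 := fun y => by
    rw [h y, Submodule.mem_dualAnnihilator]
    constructor
    · exact fun hf j hj => hf _ (Submodule.subset_span ⟨j, hj, rfl⟩)
    · intro hf w hw
      have : Submodule.span ℂ (b '' {j | a j ≤ y}) ≤ LinearMap.ker f := by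
        rw [Submodule.span_le]
        rintro _ ⟨j, hj, rfl⟩
        exact hf j hj
      exact this hw
  simp only [hmem]
  constructor
  · intro hf j hj
    by_contra hlt
    have hlt' : a j < -x := by
      have : ¬ -a j ≤ x := hlt
      linarith
    rw [SetLike.mem_coe, Finsupp.mem_support_iff, Basis.dualBasis_repr] at hj
    exact hj (hf (a j) hlt' j le_rfl)
  · intro hf y hy j hj
    by_contra hne
    have : j ∈ {j | -a j ≤ x} := hf (by
      rw [SetLike.mem_coe, Finsupp.mem_support_iff, Basis.dualBasis_repr]
      exact hne)
    have : -a j ≤ x := this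
    linarith

theorem Adapted.not_isTrivial (h : F.Adapted b a) (hpos : 0 < weightCov a a) : ¬ F.IsTrivial := by
  intro ht
  rcases isEmpty_or_nonempty ι with hι | ⟨⟨i⟩⟩
  · simp [weightCov] at hpos
  · have : a = fun _ => a i := funext fun j => h.weight_eq ht j i
    rw [this, weightCov_const_left] at hpos
    exact lt_irrefl _ hpos

/-- The diagonal pair shows that the choice in the definition is not vacuous, and `trace_mul_eq`
that every admissible pair yields the same number. -/
theorem tracePairing_eq (hF : F.Adapted b a) (hG : G.Adapted b c) :
    F.tracePairing G = ∑ j, a j * c j := by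
  have : FiniteDimensional ℂ V := b.finiteDimensional_of_finite
  obtain ⟨A, B, hAB, hA, hB, h⟩ := Classical.epsilon_spec (p := fun p : ℝ =>
    ∃ A B : Module.End ℂ V, Commute A B ∧ F.IsGenerator A ∧ G.IsGenerator B ∧
      (p : ℂ) = LinearMap.trace ℂ V (A * B))
    ⟨_, _, _, commute_diagEnd b a c, hF.isGenerator, hG.isGenerator, (trace_diagEnd_mul b a c).symm⟩
  refine Complex.ofReal_injective (h.trans ?_)
  rw [hA.trace_mul_eq hB hF.isGenerator hG.isGenerator hAB (commute_diagEnd b a c),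
    trace_diagEnd_mul]

theorem IsGenerator.glKillingForm_eq {A B : Module.End ℂ V} (hA : F.IsGenerator A)
    (hB : G.IsGenerator B) (hAB : Commute A B) (hF : F.Adapted b a) (hG : G.Adapted b c) :
    glKillingForm V A B = ((2 * weightCov a c : ℝ) : ℂ) := by
  have : FiniteDimensional ℂ V := b.finiteDimensional_of_finite
  rw [← glKillingForm_diagEnd b, glKillingForm_apply, glKillingForm_apply,
    hA.trace_mul_eq hB hF.isGenerator hG.isGenerator hAB (commute_diagEnd b a c),
    hA.trace_eq hF.isGenerator, hB.trace_eq hG.isGenerator]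

theorem killingPairing_eq (hF : F.Adapted b a) (hG : G.Adapted b c) :
    F.killingPairing G = 2 * weightCov a c := by
  obtain ⟨A, B, hAB, hA, hB, h⟩ := Classical.epsilon_spec (p := fun p : ℝ =>
    ∃ A B : Module.End ℂ V, Commute A B ∧ F.IsGenerator A ∧ G.IsGenerator B ∧
      (p : ℂ) = glKillingForm V A B)
    ⟨_, _, _, commute_diagEnd b a c, hF.isGenerator, hG.isGenerator,
      (glKillingForm_diagEnd b a c).symm⟩
  exact Complex.ofReal_injective (h.trans (hA.glKillingForm_eq hB hAB hF hG))

theorem weightCov_affine (k s k' s' : ℝ) :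
    weightCov (fun j => k * a j + s) (fun j => k' * c j + s') = k * k' * weightCov a c := by
  have := weightCov_shift (fun j => k * a j) (fun j => k' * c j) (-s) (-s')
  simp only [sub_neg_eq_add] at this
  rw [this]
  simp only [weightCov, ← Finset.mul_sum, mul_mul_mul_comm]
  ring

/-- Subtracting the mean weights gives traceless representatives. Any other representatives of the
two points have weights k a + s and l c + t with k, l > 0; the shifts do not affect `weightCov` and
the factor k l cancels in the cosine. -/
theorem titsDist_eq (hF : F.Adapted b a) (hG : G.Adapted b c) (hFt : ¬ F.IsTrivial)
    (hGt : ¬ G.IsTrivial) :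
    Building.titsDist (Quotient.mk _ ⟨F, hFt⟩ : Building V) (Quotient.mk _ ⟨G, hGt⟩) =
      Real.arccos (weightCov a c / (√(weightCov a a) * √(weightCov c c))) := by
  have : FiniteDimensional ℂ V := b.finiteDimensional_of_finite
  -- A nontrivial flag needs V ≠ 0; this permits dividing by N to form the means.
  have hN : Nonempty ι := by
    by_contra hι
    rw [not_nonempty_iff] at hι
    have hsub := b.repr.toEquiv.subsingleton
    exact hFt fun x => Or.inl (Subsingleton.elim _ _)
  have hN0 : (Fintype.card ι : ℝ) ≠ 0 := by exact_mod_cast Fintype.card_ne_zero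
  have htr : ∀ x : ι → ℝ, LinearMap.trace ℂ V
      (diagEnd b fun j => x j - (∑ i, x i) / Fintype.card ι) = 0 := fun x => by
    rw [trace_diagEnd, Finset.sum_sub_distrib, Finset.sum_const, Finset.card_univ, nsmul_eq_mul,
      mul_div_cancel₀ _ hN0, sub_self, Complex.ofReal_zero]
  have hrel : ∀ (F : WeightedFlag V) (hFt : ¬ F.IsTrivial) (s : ℝ),
      (Quotient.mk _ ⟨F.shift s, not_isTrivial_shift hFt s⟩ : Building V) =
        Quotient.mk _ ⟨F, hFt⟩ := fun F hFt s =>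
    Quotient.sound ⟨1, one_pos, s, fun x => by simp [WeightedFlag.shift]⟩
  obtain ⟨F', G', A, B, hF', hG', hAB, hA, hB, -, -, hθ⟩ := Classical.epsilon_spec
    (p := fun θ : ℝ => ∃ (F' G' : {F : WeightedFlag V // ¬ F.IsTrivial}) (A B : Module.End ℂ V),
      (Quotient.mk _ F' : Building V) = Quotient.mk _ ⟨F, hFt⟩ ∧
      (Quotient.mk _ G' : Building V) = Quotient.mk _ ⟨G, hGt⟩ ∧
      Commute A B ∧ F'.1.IsGenerator A ∧ G'.1.IsGenerator B ∧
      LinearMap.trace ℂ V A = 0 ∧ LinearMap.trace ℂ V B = 0 ∧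
      θ = Real.arccos ((glKillingForm V A B).re /
        (√(glKillingForm V A A).re * √(glKillingForm V B B).re)))
    ⟨_, _, _, _, _, hrel F hFt ((∑ i, a i) / Fintype.card ι),
      hrel G hGt ((∑ i, c i) / Fintype.card ι), commute_diagEnd b _ _, (hF.shift _).isGenerator,
      (hG.shift _).isGenerator, htr a, htr c, rfl⟩
  obtain ⟨k, hk, s, hs⟩ := Quotient.exact hF'.symm
  obtain ⟨l, hl, t, ht⟩ := Quotient.exact hG'.symm
  have hFa := hF.of_rel hk hs
  have hGc := hG.of_rel hl ht
  refine Eq.trans hθ ?_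
  rw [hA.glKillingForm_eq hB hAB hFa hGc,
    hA.glKillingForm_eq hA (Commute.refl A) hFa hFa,
    hB.glKillingForm_eq hB (Commute.refl B) hGc hGc]
  simp only [Complex.ofReal_re, weightCov_affine]
  have hsq : ∀ x : ℝ, ∀ k : ℝ, 0 < k → √(2 * (k * k * x)) = √2 * (k * √x) := fun x k hk => by
    rw [Real.sqrt_mul (by norm_num), Real.sqrt_mul (by positivity), Real.sqrt_mul_self hk.le]
  rw [hsq _ _ hk, hsq _ _ hl]
  congr 1
  rw [show √2 * (k * √(weightCov a a)) * (√2 * (l * √(weightCov c c))) =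
    (√2 * √2 * (k * l)) * (√(weightCov a a) * √(weightCov c c)) by ring,
    Real.mul_self_sqrt (by norm_num), show 2 * (k * l * weightCov a c) =
    (2 * (k * l)) * weightCov a c by ring]
  exact mul_div_mul_left _ _ (by positivity)

end WeightedFlag

/-- `f` agrees with a polynomial for large arguments. -/
def EventuallyPoly (f : ℕ → ℝ) : Prop :=
  ∃ p : Polynomial ℝ, ∀ᶠ k in atTop, f k = p.eval (k : ℝ)

namespace EventuallyPoly

variable {f g : ℕ → ℝ}

theorem zero : EventuallyPoly fun _ => 0 := ⟨0, by simp⟩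

theorem congr (hf : EventuallyPoly f) (h : ∀ᶠ k in atTop, g k = f k) : EventuallyPoly g := by
  obtain ⟨p, hp⟩ := hf
  exact ⟨p, by filter_upwards [hp, h] with k h1 h2 using h2.trans h1⟩

theorem add (hf : EventuallyPoly f) (hg : EventuallyPoly g) :
    EventuallyPoly fun k => f k + g k := by
  obtain ⟨p, hp⟩ := hf
  obtain ⟨q, hq⟩ := hg
  exact ⟨p + q, by filter_upwards [hp, hq] with k h1 h2 using by simp [h1, h2]⟩

theorem sub (hf : EventuallyPoly f) (hg : EventuallyPoly g) :
    EventuallyPoly fun k => f k - g k := by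
  obtain ⟨p, hp⟩ := hf
  obtain ⟨q, hq⟩ := hg
  exact ⟨p - q, by filter_upwards [hp, hq] with k h1 h2 using by simp [h1, h2]⟩

theorem succ (hf : EventuallyPoly f) : EventuallyPoly fun k => f (k + 1) := by
  obtain ⟨p, hp⟩ := hf
  refine ⟨p.comp (Polynomial.X + 1), ?_⟩
  filter_upwards [(tendsto_add_atTop_nat 1).eventually hp] with k hk
  simp [hk]

end EventuallyPoly

/-- Bernoulli polynomials solve the monomial case: Bₙ₊₁(x + 1) - Bₙ₊₁(x) = (n + 1) xⁿ. -/
theorem exists_comp_succ_sub_eq (p : Polynomial ℝ) :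
    ∃ q : Polynomial ℝ, ∀ x : ℝ, q.eval (x + 1) - q.eval x = p.eval x := by
  induction p using Polynomial.induction_on' with
  | add p q hp hq =>
    obtain ⟨p', hp⟩ := hp
    obtain ⟨q', hq⟩ := hq
    refine ⟨p' + q', fun x => ?_⟩
    rw [Polynomial.eval_add, Polynomial.eval_add, Polynomial.eval_add, ← hp, ← hq]
    ring
  | monomial n a =>
    have hB : ((Polynomial.bernoulli (n + 1)).map (algebraMap ℚ ℝ)).comp (1 + Polynomial.X) =
        (Polynomial.bernoulli (n + 1)).map (algebraMap ℚ ℝ) +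
          Polynomial.C ((n : ℝ) + 1) * Polynomial.X ^ n := by
      have := congrArg (Polynomial.map (algebraMap ℚ ℝ))
        (Polynomial.bernoulli_comp_one_add_X (n + 1))
      simpa [Polynomial.map_comp] using this
    refine ⟨Polynomial.C (a / (n + 1)) * (Polynomial.bernoulli (n + 1)).map (algebraMap ℚ ℝ),
      fun x => ?_⟩
    have hx := congrArg (Polynomial.eval x) hB
    simp only [Polynomial.eval_comp, Polynomial.eval_add, Polynomial.eval_one, Polynomial.eval_X,
      Polynomial.eval_mul, Polynomial.eval_C, Polynomial.eval_pow] at hx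
    rw [Polynomial.eval_mul, Polynomial.eval_mul, add_comm x 1, hx, Polynomial.eval_C,
      Polynomial.eval_C, Polynomial.eval_monomial]
    field_simp
    ring

theorem EventuallyPoly.of_succ_sub {f : ℕ → ℝ} (hf : EventuallyPoly fun k => f (k + 1) - f k) :
    EventuallyPoly f := by
  obtain ⟨p, hp⟩ := hf
  obtain ⟨q, hq⟩ := exists_comp_succ_sub_eq p
  obtain ⟨K, hK⟩ := eventually_atTop.1 hp
  refine ⟨q + Polynomial.C (f K - q.eval (K : ℝ)), eventually_atTop.2 ⟨K, fun k hk => ?_⟩⟩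
  induction k, hk using Nat.le_induction with
  | base => simp
  | succ k hk ih =>
    have h1 := hK k hk
    rw [← hq] at h1
    simp only [Polynomial.eval_add, Polynomial.eval_C] at ih ⊢
    push_cast
    linarith

/-- A function that is eventually polynomial and `O(kᵉ)` is asymptotic to a multiple of `kᵉ`. -/
theorem EventuallyPoly.exists_tendsto {f : ℕ → ℝ} (hf : EventuallyPoly f) {e : ℕ} {C : ℝ}
    (hC : ∀ᶠ k : ℕ in atTop, |f k| ≤ C * (k : ℝ) ^ e) :
    ∃ L, Tendsto (fun k : ℕ => f k / (k : ℝ) ^ e) atTop (nhds L) := by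
  obtain ⟨p, hp⟩ := hf
  have hcongr : (fun k : ℕ => p.eval (k : ℝ) / (Polynomial.X ^ e).eval (k : ℝ)) =ᶠ[atTop]
      fun k : ℕ => f k / (k : ℝ) ^ e := by
    filter_upwards [hp] with k hk
    simp [hk]
  rcases lt_trichotomy p.degree (Polynomial.X ^ e : Polynomial ℝ).degree with h | h | h
  · exact ⟨0, ((Polynomial.div_tendsto_atTop_zero_of_degree_lt p _ h).comp
      tendsto_natCast_atTop_atTop).congr' hcongr⟩
  · exact ⟨_, ((Polynomial.div_tendsto_atTop_leadingCoeff_div_of_degree_eq p _ h).comp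
      tendsto_natCast_atTop_atTop).congr' hcongr⟩
  -- A degree above e would make |f k| / kᵉ unbounded.
  · exfalso
    have h1 := ((Polynomial.abs_div_tendsto_atTop_atTop_of_degree_gt p _ h
      (pow_ne_zero e Polynomial.X_ne_zero)).comp tendsto_natCast_atTop_atTop).eventually_gt_atTop C
    obtain ⟨k, h1, h2, h3, h4⟩ :=
      (h1.and (hC.and (hp.and (eventually_gt_atTop 0)))).exists
    have hk : (0 : ℝ) < (k : ℝ) ^ e := by positivity
    simp only [Function.comp_apply, Polynomial.eval_pow, Polynomial.eval_X] at h1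
    rw [← h3, abs_div, abs_of_pos hk, lt_div_iff₀ hk] at h1
    linarith

section Piece

variable {S : Type v} [CommRing S] [Algebra ℂ S] (𝒜 : ℕ × ℤ → Submodule ℂ S)

/-- The graded piece of an ideal. -/
def piece (P : Ideal S) (p : ℕ × ℤ) : Submodule ℂ S := P.restrictScalars ℂ ⊓ 𝒜 p

/-- The bigraded Hilbert function of an ideal. -/
def pieceDim (P : Ideal S) (p : ℕ × ℤ) : ℕ := finrank ℂ (piece 𝒜 P p)

variable {𝒜}

section

variable [∀ p, FiniteDimensional ℂ (𝒜 p)] {P Q : Ideal S}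

instance (P : Ideal S) (p : ℕ × ℤ) : FiniteDimensional ℂ (piece 𝒜 P p) :=
  Submodule.finiteDimensional_of_le (inf_le_right : _ ≤ 𝒜 p)

theorem pieceDim_mono (h : Q ≤ P) (p : ℕ × ℤ) : pieceDim 𝒜 Q p ≤ pieceDim 𝒜 P p :=
  Submodule.finrank_mono (inf_le_inf_right _ h)

theorem pieceDim_eq_of_le {p : ℕ × ℤ} (h : piece 𝒜 P p ≤ piece 𝒜 Q p) (hQP : Q ≤ P) :
    pieceDim 𝒜 P p = pieceDim 𝒜 Q p :=
  le_antisymm (Submodule.finrank_mono h) (pieceDim_mono hQP p)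

end

variable [GradedAlgebra 𝒜] {P Q : Ideal S} {x : S} {d : ℕ × ℤ}

theorem decompose_mul_add (hx : x ∈ 𝒜 d) (s : S) (p : ℕ × ℤ) :
    (DirectSum.decompose 𝒜 (x * s) (d + p) : S) = x * DirectSum.decompose 𝒜 s p :=
  DirectSum.coe_decompose_mul_add_of_left_mem 𝒜 hx

theorem isHomogeneous_colon (hx : x ∈ 𝒜 d) (hQ : Q.IsHomogeneous 𝒜) :
    Ideal.IsHomogeneous 𝒜 (Submodule.comap (LinearMap.mulLeft S x) Q) := by
  intro p s hs
  show x * _ ∈ Q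
  rw [← decompose_mul_add hx]
  exact hQ _ hs

theorem isHomogeneous_span_singleton (hx : x ∈ 𝒜 d) : Ideal.IsHomogeneous 𝒜 (Ideal.span {x}) :=
  Ideal.homogeneous_span 𝒜 _ fun y hy => ⟨d, by rwa [Set.mem_singleton_iff.1 hy]⟩

variable [∀ p, FiniteDimensional ℂ (𝒜 p)]

/-- Multiplication by a homogeneous `x` induces an exact sequence
`0 → (P ∩ (Q : x)) / Q → P / Q → P / Q → P / (xP + Q) → 0`. -/
theorem pieceDim_exact (hx : x ∈ 𝒜 d) (hP : P.IsHomogeneous 𝒜) (hQ : Q.IsHomogeneous 𝒜)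
    (p : ℕ × ℤ) : pieceDim 𝒜 P p + pieceDim 𝒜 Q (d + p) =
      pieceDim 𝒜 (P ⊓ Submodule.comap (LinearMap.mulLeft S x) Q) p +
        pieceDim 𝒜 (Ideal.span {x} * P ⊔ Q) (d + p) := by
  -- Rank–nullity for (a, b) ↦ x a + b. Its range is the piece of xP + Q, and its kernel is
  -- identified by the first coordinate with those a in P such that x a lies in Q.
  let ψ : piece 𝒜 P p × piece 𝒜 Q (d + p) →ₗ[ℂ] S :=
    (LinearMap.mulLeft ℂ x ∘ₗ (piece 𝒜 P p).subtype).coprod (piece 𝒜 Q (d + p)).subtype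
  have hψ : ∀ a, ψ a = x * a.1 + a.2 := fun a => rfl
  have hrange : LinearMap.range ψ = piece 𝒜 (Ideal.span {x} * P ⊔ Q) (d + p) := by
    apply le_antisymm
    · rintro _ ⟨⟨⟨a, ha, ha'⟩, ⟨b, hb, hb'⟩⟩, rfl⟩
      refine ⟨?_, add_mem (SetLike.mul_mem_graded hx ha') hb'⟩
      exact Submodule.add_mem_sup (Ideal.mem_span_singleton_mul.2 ⟨a, ha, rfl⟩) hb
    · rintro s ⟨hs, hs'⟩
      obtain ⟨y, hy, q, hq, rfl⟩ := Submodule.mem_sup.1 hs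
      obtain ⟨z, hz, rfl⟩ := Ideal.mem_span_singleton_mul.1 hy
      refine ⟨(⟨DirectSum.decompose 𝒜 z p, hP p hz, SetLike.coe_mem _⟩,
        ⟨DirectSum.decompose 𝒜 q (d + p), hQ _ hq, SetLike.coe_mem _⟩), ?_⟩
      rw [hψ, ← decompose_mul_add hx, ← Submodule.coe_add, ← DirectSum.add_apply,
        ← DirectSum.decompose_add, DirectSum.decompose_of_mem_same 𝒜 hs']
  have hker : finrank ℂ (LinearMap.ker ψ) =
      pieceDim 𝒜 (P ⊓ Submodule.comap (LinearMap.mulLeft S x) Q) p := by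
    refine LinearEquiv.finrank_eq (LinearEquiv.ofBijective
      ((LinearMap.fst ℂ _ _ ∘ₗ (LinearMap.ker ψ).subtype).codRestrict
        ((piece 𝒜 (P ⊓ Submodule.comap (LinearMap.mulLeft S x) Q) p).comap
          (piece 𝒜 P p).subtype) ?_) ⟨?_, ?_⟩ |>.trans
        (Submodule.comapSubtypeEquivOfLe fun s hs => ⟨hs.1.1, hs.2⟩))
    · rintro ⟨⟨a, b⟩, hab⟩
      refine ⟨⟨a.2.1, ?_⟩, a.2.2⟩
      have h : x * (a : S) = -b := eq_neg_of_add_eq_zero_left hab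
      show x * (a : S) ∈ Q
      rw [h]
      exact neg_mem b.2.1
    · rintro ⟨⟨a, b⟩, hab⟩ ⟨⟨a', b'⟩, hab'⟩ h
      have h1 : a = a' := congrArg Subtype.val h
      subst h1
      have h2 : (b : S) = -(x * a) := eq_neg_of_add_eq_zero_right hab
      have h3 : (b' : S) = -(x * a) := eq_neg_of_add_eq_zero_right hab'
      have h4 : b = b' := Subtype.ext (h2.trans h3.symm)
      subst h4
      rfl
    · rintro ⟨a, ⟨⟨ha, ha'⟩, ha''⟩⟩
      refine ⟨⟨(a, ⟨-(x * a), neg_mem ha', neg_mem (SetLike.mul_mem_graded hx ha'')⟩), ?_⟩, rfl⟩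
      rw [LinearMap.mem_ker, hψ]
      exact add_neg_cancel _
  have := LinearMap.finrank_range_add_finrank_ker ψ
  rw [hrange, hker, Module.finrank_prod] at this
  rw [pieceDim, pieceDim, ← this, add_comm]
  rfl

end Piece

namespace TestConfiguration

variable {X : PolarisedVariety.{u}} {r : ℕ} (T : TestConfiguration.{u, v} X r)

/-- The coordinate of the base. -/
def t : T.sectionRing := algebraMap (Polynomial ℂ) T.sectionRing Polynomial.X

theorem t_mem : T.t ∈ T.grade (0, 1) := T.base_mem

/-- Flatness over ℂ[t] makes the nonzerodivisor t act injectively. -/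
theorem t_mul_injective {s : T.sectionRing} (h : T.t * s = 0) : s = 0 := by
  have := T.flat
  have hreg : IsSMulRegular T.sectionRing (Polynomial.X : Polynomial ℂ) :=
    Module.Flat.isSMulRegular_of_nonZeroDivisors (R := Polynomial ℂ) (M := T.sectionRing)
      (mem_nonZeroDivisors_of_ne_zero Polynomial.X_ne_zero)
  refine hreg ?_
  show (Polynomial.X : Polynomial ℂ) • s = (Polynomial.X : Polynomial ℂ) • 0
  rw [smul_zero, Algebra.smul_def]
  exact h

theorem decompose_t_mul (s : T.sectionRing) (k : ℕ) (i : ℤ) :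
    (DirectSum.decompose T.grade (T.t * s) (k, i) : T.sectionRing) =
      T.t * DirectSum.decompose T.grade s (k, i - 1) := by
  have := decompose_mul_add T.t_mem s (k, i - 1)
  rwa [Prod.mk_add_mk, zero_add, add_sub_cancel] at this

theorem exists_decompose_eq_zero (s : T.sectionRing) (k : ℕ) :
    ∃ M : ℤ, ∀ i, M < |i| → (DirectSum.decompose T.grade s (k, i) : T.sectionRing) = 0 := by
  classical
  refine ⟨∑ p ∈ (DirectSum.decompose T.grade s).support, |p.2|, fun i hi => ?_⟩
  by_contra h
  have hmem : (k, i) ∈ (DirectSum.decompose T.grade s).support := by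
    rw [DFinsupp.mem_support_iff]
    exact fun h0 => h (by rw [h0]; rfl)
  exact hi.not_ge (Finset.single_le_sum (f := fun p : ℕ × ℤ => |p.2|) (fun p _ => abs_nonneg _) hmem)

/-- Restriction to the fibre over `1` is injective on sections of a fixed weight. -/
theorem fibre_injective {k : ℕ} {i : ℤ} {s : T.sectionRing} (hs : s ∈ T.grade (k, i))
    (h : T.fibre s = 0) : s = 0 := by
  have hker : s ∈ RingHom.ker T.fibre := h
  rw [T.ker_fibre, Ideal.mem_span_singleton] at hker
  obtain ⟨w, hw⟩ := hker
  have hw' : s = T.t * w - w := by rw [hw, sub_mul, one_mul]; rfl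
  have hcomp : ∀ j, (DirectSum.decompose T.grade s (k, j) : T.sectionRing) =
      T.t * DirectSum.decompose T.grade w (k, j - 1) - DirectSum.decompose T.grade w (k, j) := by
    intro j
    rw [← decompose_t_mul, hw', DirectSum.decompose_sub, DirectSum.sub_apply]
    rfl
  -- With s = (t - 1) w, comparing weights gives w_j = t w_{j-1} for j ≠ i. As w has finitely many
  -- components, ascending from the bottom kills w_j for j < i, and descending from the top, by
  -- injectivity of t, kills w_j for j ≥ i. Hence s = t w_{i-1} - w_i = 0.
  have hrec : ∀ j, j ≠ i → (DirectSum.decompose T.grade w (k, j) : T.sectionRing) =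
      T.t * DirectSum.decompose T.grade w (k, j - 1) := by
    intro j hj
    have := hcomp j
    rw [DirectSum.decompose_of_mem_ne T.grade hs (by simpa using hj.symm)] at this
    exact (sub_eq_zero.1 this.symm).symm
  obtain ⟨M, hM⟩ := T.exists_decompose_eq_zero w k
  have hlow : ∀ n : ℕ, ∀ j, j < i → j ≤ -M - 1 + n →
      (DirectSum.decompose T.grade w (k, j) : T.sectionRing) = 0 := by
    intro n
    induction n with
    | zero => exact fun j _ hj => hM j (by rw [lt_abs]; right; push_cast at hj; omega)
    | succ n ih =>
      intro j hji hj
      rw [hrec j hji.ne, ih (j - 1) (by omega) (by push_cast at hj; omega), mul_zero]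
  have hhigh : ∀ n : ℕ, ∀ j, i ≤ j → M + 1 - n ≤ j →
      (DirectSum.decompose T.grade w (k, j) : T.sectionRing) = 0 := by
    intro n
    induction n with
    | zero => exact fun j _ hj => hM j (by rw [lt_abs]; left; push_cast at hj; omega)
    | succ n ih =>
      intro j hij hj
      refine T.t_mul_injective ?_
      have := hrec (j + 1) (by omega)
      rw [add_sub_cancel_right] at this
      rw [← this]
      exact ih (j + 1) (by omega) (by push_cast at hj; omega)
  rw [← DirectSum.decompose_of_mem_same T.grade hs, hcomp,
    hlow (i - 1 + M + 1).toNat (i - 1) (by omega) (by omega),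
    hhigh (M + 1 - i).toNat i le_rfl (by omega), mul_zero, sub_zero]

theorem fibre_mem {k : ℕ} {i : ℤ} {s : T.sectionRing} (hs : s ∈ T.grade (k, i)) :
    T.fibre s ∈ X.sec (r * k) := by
  rw [← T.map_fibre]
  exact ⟨s, Submodule.mem_iSup_of_mem i hs, rfl⟩

/-- Restriction of sections of weight `i` to the fibre over `1`. -/
def fibreGrade (k : ℕ) (i : ℤ) : T.grade (k, i) →ₗ[ℂ] X.sec (r * k) :=
  (T.fibre.toLinearMap ∘ₗ (T.grade (k, i)).subtype).codRestrict _ fun s => T.fibre_mem s.2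

theorem fibreGrade_injective (k : ℕ) (i : ℤ) : Function.Injective (T.fibreGrade k i) := by
  rw [injective_iff_map_eq_zero]
  intro s hs
  exact Subtype.ext (T.fibre_injective s.2 (congrArg Subtype.val hs))

instance (p : ℕ × ℤ) : FiniteDimensional ℂ (T.grade p) :=
  Module.Finite.of_injective _ (T.fibreGrade_injective p.1 p.2)

theorem finrank_grade_le (k : ℕ) (i : ℤ) : finrank ℂ (T.grade (k, i)) ≤ finrank ℂ (X.sec (r * k)) :=
  LinearMap.finrank_le_finrank_of_injective (T.fibreGrade_injective k i)

theorem finrank_filt (k : ℕ) (i : ℤ) :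
    finrank ℂ (T.filt (r * k) i) = finrank ℂ (T.grade (k, i)) := by
  have h : T.filt (r * k) i = LinearMap.range (T.fibreGrade k i) := by
    ext s
    rw [filt, Nat.mul_div_cancel_left k T.exponent_pos]
    constructor
    · rintro ⟨σ, hσ, hs⟩
      exact ⟨⟨σ, hσ⟩, Subtype.ext hs⟩
    · rintro ⟨σ, rfl⟩
      exact ⟨σ, σ.2, rfl⟩
  rw [h, LinearMap.finrank_range_of_inj (T.fibreGrade_injective k i)]

theorem grDim_add {V : Type u} [AddCommGroup V] [Module ℂ V] [FiniteDimensional ℂ V]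
    {F : ℤ → Submodule ℂ V} (hF : Monotone F) (i : ℤ) :
    grDim F i + finrank ℂ (F (i - 1)) = finrank ℂ (F i) := by
  have h := Submodule.finrank_quotient_add_finrank ((F (i - 1)).submoduleOf (F i))
  rwa [(Submodule.submoduleOfEquivOfLe (hF (by omega : i - 1 ≤ i))).finrank_eq] at h

theorem pieceDim_top (p : ℕ × ℤ) : pieceDim T.grade ⊤ p = finrank ℂ (T.grade p) := by
  rw [pieceDim, piece, Submodule.restrictScalars_top, top_inf_eq]

theorem pieceDim_span_t (k : ℕ) (i : ℤ) :
    pieceDim T.grade (Ideal.span {T.t}) (k, i) = finrank ℂ (T.grade (k, i - 1)) := by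
  have h := pieceDim_exact (𝒜 := T.grade) T.t_mem (Ideal.IsHomogeneous.top _)
    (Ideal.IsHomogeneous.bot _) (k, i - 1)
  have h1 : (⊤ ⊓ Submodule.comap (LinearMap.mulLeft T.sectionRing T.t) ⊥ : Ideal T.sectionRing) = ⊥ :=
    (Submodule.eq_bot_iff _).2 fun s hs => T.t_mul_injective hs.2
  have h2 : ∀ p, pieceDim T.grade ⊥ p = 0 := fun p => by
    rw [pieceDim, piece, Submodule.restrictScalars_bot, bot_inf_eq, finrank_bot]
  rw [h1, h2, h2, pieceDim_top, Ideal.mul_top, sup_bot_eq, add_zero, zero_add] at h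
  rw [h]
  simp

/-- On sections of weight i - 1 the inclusion of filtration steps is multiplication by t, so gr_i
has the dimension of the weight i part of S/tS. -/
theorem grDim_filt (k : ℕ) (i : ℤ) : (grDim (T.filt (r * k)) i : ℝ) =
    (pieceDim T.grade ⊤ (k, i) : ℝ) - pieceDim T.grade (Ideal.span {T.t}) (k, i) := by
  rw [pieceDim_top, pieceDim_span_t, ← finrank_filt, ← finrank_filt,
    ← grDim_add (T.filt_mono (r * k)) i]
  push_cast
  ring

variable {T} {P Q : Ideal T.sectionRing}

/-- The two filtrations `tP ⊆ Q ⊆ P` have the same dimension in all but finitely many weights. -/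
theorem finite_support_sub (hQP : Q ≤ P)
    (ht : ∀ s ∈ P, T.t * s ∈ Q) (k : ℕ) :
    {i : ℤ | pieceDim T.grade P (k, i) ≠ pieceDim T.grade Q (k, i)}.Finite := by
  obtain ⟨c, hc⟩ := T.exists_weight_bound
  have hstep : ∀ i, pieceDim T.grade P (k, i) ≤ pieceDim T.grade Q (k, i + 1) := by
    intro i
    have hmap : ∀ s : piece T.grade P (k, i), T.t * s ∈ piece T.grade Q (k, i + 1) := fun s =>
      ⟨ht _ s.2.1, by
        have := SetLike.mul_mem_graded T.t_mem s.2.2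
        rwa [Prod.mk_add_mk, zero_add, add_comm 1 i] at this⟩
    refine LinearMap.finrank_le_finrank_of_injective (f := (LinearMap.mulLeft ℂ T.t ∘ₗ
      (piece T.grade P (k, i)).subtype).codRestrict _ hmap) ?_
    rw [injective_iff_map_eq_zero]
    intro s hs
    exact Subtype.ext (T.t_mul_injective (congrArg Subtype.val hs))
  have hmono : Monotone fun i => pieceDim T.grade P (k, i) :=
    monotone_int_of_le_succ fun i => (hstep i).trans (pieceDim_mono hQP _)
  have hbdd : ∀ i, pieceDim T.grade P (k, i) ≤ finrank ℂ (X.sec (r * k)) := fun i =>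
    ((pieceDim_mono le_top _).trans_eq (T.pieceDim_top _)).trans (T.finrank_grade_le k i)
  -- The dimensions of P increase with the weight and are bounded by h(rk), so they reach a maximum
  -- at some i₀. For i > i₀, P_i has at most the dimension of P_{i-1}, which t embeds into Q_i.
  obtain ⟨i₀, hi₀⟩ : ∃ i₀, ∀ i, pieceDim T.grade P (k, i) ≤ pieceDim T.grade P (k, i₀) := by
    have hfin : (Set.range fun i => pieceDim T.grade P (k, i)).Finite :=
      (Set.finite_Iic (finrank ℂ (X.sec (r * k)))).subset (by rintro _ ⟨i, rfl⟩; exact hbdd i)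
    obtain ⟨_, ⟨i₀, rfl⟩, h⟩ := hfin.exists_maximal (Set.range_nonempty _) |>.imp fun _ h => h
    refine ⟨i₀, fun i => ?_⟩
    by_contra! hlt
    exact hlt.not_ge (h ⟨i, rfl⟩ hlt.le)
  refine (Set.finite_Icc (-(c * k)) (i₀ + 1)).subset fun i hi => ?_
  rw [Set.mem_Icc]
  by_contra hout
  refine hi ?_
  rcases lt_or_ge i (-(c * k)) with h | h
  · have h0 : ∀ R : Ideal T.sectionRing, pieceDim T.grade R (k, i) = 0 := fun R => by
      rw [pieceDim, piece, hc k i h, inf_bot_eq, finrank_bot]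
    rw [h0, h0]
  · have h1 : i₀ ≤ i - 1 := by
      by_contra! h2
      exact hout ⟨h, by omega⟩
    refine le_antisymm ((hi₀ i).trans ((hmono h1).trans ?_)) (pieceDim_mono hQP _)
    have := hstep (i - 1)
    rwa [sub_add_cancel] at this

end TestConfiguration

namespace TestConfiguration

variable {X : PolarisedVariety.{u}} {r : ℕ} (T : TestConfiguration.{u, v} X r)

/-- The ideal generated by `H⁰(𝒳, ℒ)`. -/
def degreeOneIdeal : Ideal T.sectionRing :=
  Ideal.span (⋃ j : ℤ, (T.grade (1, j) : Set T.sectionRing))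

theorem isHomogeneous_degreeOneIdeal : T.degreeOneIdeal.IsHomogeneous T.grade := by
  refine Ideal.homogeneous_span _ _ fun s hs => ?_
  obtain ⟨j, hj⟩ := Set.mem_iUnion.1 hs
  exact ⟨(1, j), hj⟩

theorem algebraMap_mem (p : Polynomial ℂ) : algebraMap (Polynomial ℂ) T.sectionRing p ∈
    ⨆ j : ℕ, T.grade (0, (j : ℤ)) := by
  induction p using Polynomial.induction_on' with
  | add p q hp hq => rw [map_add]; exact Submodule.add_mem _ hp hq
  | monomial n a =>
    have : algebraMap (Polynomial ℂ) T.sectionRing (Polynomial.monomial n a) = a • T.t ^ n := by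
      rw [← Polynomial.smul_X_eq_monomial, t, ← map_pow,
        Algebra.algebraMap_eq_smul_one, Algebra.algebraMap_eq_smul_one, smul_assoc]
    rw [this]
    refine Submodule.mem_iSup_of_mem n (Submodule.smul_mem _ _ ?_)
    have := SetLike.pow_mem_graded n T.t_mem
    simpa using this

theorem decompose_algebraMap (p : Polynomial ℂ) {k : ℕ} (hk : k ≠ 0) (i : ℤ) :
    (DirectSum.decompose T.grade (algebraMap (Polynomial ℂ) T.sectionRing p) (k, i) :
      T.sectionRing) = 0 := by
  have h := T.algebraMap_mem p
  generalize algebraMap (Polynomial ℂ) T.sectionRing p = s at h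
  induction h using Submodule.iSup_induction' with
  | mem j x hx =>
    exact DirectSum.decompose_of_mem_ne T.grade hx fun h => hk (congrArg Prod.fst h).symm
  | zero => simp
  | add x y _ _ h h' => rw [DirectSum.decompose_add, DirectSum.add_apply, Submodule.coe_add, h, h',
      add_zero]

/-- Modulo this ideal the algebra generated by degree one reduces to the image of ℂ[t], which has no
component in positive degree; the threshold k₀ + 1 ensures k ≠ 0. -/
theorem exists_grade_le_degreeOneIdeal : ∃ k₀, ∀ k ≥ k₀, ∀ i, ∀ s ∈ T.grade (k, i),
    s ∈ T.degreeOneIdeal := by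
  obtain ⟨k₀, hk₀⟩ := T.veryAmple
  refine ⟨k₀ + 1, fun k hk i s hs => ?_⟩
  have key : ∀ y ∈ Algebra.adjoin (Polynomial ℂ) (⋃ j : ℤ, (T.grade (1, j) : Set T.sectionRing)),
      ∃ p, y - algebraMap (Polynomial ℂ) T.sectionRing p ∈ T.degreeOneIdeal := by
    intro y hy
    induction hy using Algebra.adjoin_induction with
    | mem x hx => exact ⟨0, by rw [map_zero, sub_zero]; exact Ideal.subset_span hx⟩
    | algebraMap p => exact ⟨p, by simp⟩
    | add x y _ _ hx hy =>
      obtain ⟨p, hp⟩ := hx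
      obtain ⟨q, hq⟩ := hy
      exact ⟨p + q, by rw [map_add, add_sub_add_comm]; exact add_mem hp hq⟩
    | mul x y _ _ hx hy =>
      obtain ⟨p, hp⟩ := hx
      obtain ⟨q, hq⟩ := hy
      refine ⟨p * q, ?_⟩
      rw [map_mul, show ∀ a b : T.sectionRing, x * y - a * b = x * (y - b) + b * (x - a) by
        intro a b; ring]
      exact add_mem (Ideal.mul_mem_left _ _ hq) (Ideal.mul_mem_left _ _ hp)
  obtain ⟨p, hp⟩ := key s (hk₀ k (by omega) i s hs)
  have := T.isHomogeneous_degreeOneIdeal (k, i) hp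
  rwa [DirectSum.decompose_sub, DirectSum.sub_apply, AddSubgroupClass.coe_sub,
    T.decompose_algebraMap p (by omega), sub_zero, DirectSum.decompose_of_mem_same _ hs] at this

instance : IsNoetherianRing T.sectionRing :=
  have := T.finiteType
  Algebra.FiniteType.isNoetherianRing (Polynomial ℂ) T.sectionRing

variable {T} {P Q : Ideal T.sectionRing}

/-- If sections of `ℒ` map `P` into `Q` then `P` and `Q` agree in large degrees. -/
theorem exists_piece_le (hP : P.IsHomogeneous T.grade)
    (h : T.degreeOneIdeal * P ≤ Q) :
    ∃ K, ∀ k ≥ K, ∀ i, piece T.grade P (k, i) ≤ piece T.grade Q (k, i) := by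
  obtain ⟨k₀, hk₀⟩ := T.exists_grade_le_degreeOneIdeal
  let gen : ℕ → Ideal T.sectionRing := fun D =>
    Ideal.span {s | s ∈ P ∧ ∃ k ≤ D, ∃ i, s ∈ T.grade (k, i)}
  have hgen : Monotone gen := fun D D' hD => Ideal.span_mono fun s hs =>
    ⟨hs.1, let ⟨k, hk, hi⟩ := hs.2; ⟨k, hk.trans hD, hi⟩⟩
  have hsup : P ≤ ⨆ D, gen D := by
    intro s hs
    classical
    rw [← DirectSum.sum_support_decompose T.grade s]
    refine Submodule.sum_mem _ fun p _ => ?_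
    exact Submodule.mem_iSup_of_mem p.1 (Ideal.subset_span
      ⟨hP p hs, p.1, le_rfl, p.2, SetLike.coe_mem _⟩)
  obtain ⟨D, hD⟩ := (IsNoetherian.noetherian P : P.FG).exists_le_of_le_iSup hgen hsup
  -- P is generated in degrees at most D, so in degree k ≥ D + k₀ the coefficients have degree at
  -- least k₀ and lie in `degreeOneIdeal`.
  refine ⟨D + k₀, fun k hk i s hs => ⟨?_, hs.2⟩⟩
  have key : ∀ y ∈ gen D, ∀ a : T.sectionRing,
      (DirectSum.decompose T.grade (a * y) (k, i) : T.sectionRing) ∈ Q := by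
    intro y hy
    induction hy using Submodule.span_induction with
    | mem y hy =>
      intro a
      obtain ⟨hyP, k', hk', i', hy⟩ := hy
      have hsub : ((k, i) : ℕ × ℤ) = (k - k', i - i') + (k', i') := by
        rw [Prod.mk_add_mk, Nat.sub_add_cancel (by omega), sub_add_cancel]
      rw [hsub, DirectSum.coe_decompose_mul_add_of_right_mem T.grade hy]
      exact h (Ideal.mul_mem_mul (hk₀ (k - k') (by omega) _ _ (SetLike.coe_mem _)) hyP)
    | zero => simp
    | add x y _ _ hx hy =>
      intro a
      rw [mul_add, DirectSum.decompose_add, DirectSum.add_apply, Submodule.coe_add]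
      exact add_mem (hx a) (hy a)
    | smul c y _ hy =>
      intro a
      rw [smul_eq_mul, ← mul_assoc]
      exact hy (a * c)
  have := key s (hD hs.1) 1
  rwa [one_mul, DirectSum.decompose_of_mem_same T.grade hs.2] at this

variable (P Q) in
/-- `∑ᵢ φ(i) dim (P / Q)_(k, i)`. -/
def weightedDim (φ : Polynomial ℝ) (k : ℕ) : ℝ :=
  ∑ᶠ i : ℤ, φ.eval (i : ℝ) *
    ((pieceDim T.grade P (k, i) : ℝ) - pieceDim T.grade Q (k, i))

theorem weightedDim_support (hQP : Q ≤ P) (ht : ∀ s ∈ P, T.t * s ∈ Q) (f : ℤ → ℝ) (k : ℕ) :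
    (Function.support fun i : ℤ => f i *
      ((pieceDim T.grade P (k, i) : ℝ) - pieceDim T.grade Q (k, i))).Finite := by
  refine (finite_support_sub hQP ht k).subset fun i hi h => hi ?_
  simp [h]

theorem weightedDim_add (hQP : Q ≤ P) (ht : ∀ s ∈ P, T.t * s ∈ Q) (φ ψ : Polynomial ℝ) (k : ℕ) :
    weightedDim P Q (φ + ψ) k = weightedDim P Q φ k + weightedDim P Q ψ k := by
  rw [weightedDim, weightedDim, weightedDim,
    ← finsum_add_distrib (weightedDim_support hQP ht _ k) (weightedDim_support hQP ht _ k)]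
  simp only [Polynomial.eval_add, add_mul]

/-- `pieceDim_exact` summed over all weights. Multiplication by x raises the weight by a, so φ(i)
becomes φ(i + a), a Taylor shift. -/
theorem weightedDim_succ (hQP : Q ≤ P) (ht : ∀ s ∈ P, T.t * s ∈ Q)
    (hP : P.IsHomogeneous T.grade) (hQ : Q.IsHomogeneous T.grade) {x : T.sectionRing} {a : ℤ}
    (hx : x ∈ T.grade (1, a)) (hxP : Ideal.span {x} * P ≤ P) (φ : Polynomial ℝ) (k : ℕ) :
    weightedDim P Q φ (k + 1) - weightedDim P Q (Polynomial.taylor (a : ℝ) φ) k =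
      weightedDim P (Ideal.span {x} * P ⊔ Q) φ (k + 1) -
        weightedDim (P ⊓ Submodule.comap (LinearMap.mulLeft T.sectionRing x) Q) Q
          (Polynomial.taylor (a : ℝ) φ) k := by
  have hshift : ∀ (P Q : Ideal T.sectionRing), weightedDim P Q φ (k + 1) =
      ∑ᶠ i : ℤ, (Polynomial.taylor (a : ℝ) φ).eval (i : ℝ) *
        ((pieceDim T.grade P (k + 1, i + a) : ℝ) - pieceDim T.grade Q (k + 1, i + a)) := by
    intro P Q
    rw [weightedDim, ← finsum_comp_equiv (Equiv.addRight a)]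
    simp [Polynomial.taylor_eval, add_comm]
  have hsupp : ∀ {P Q : Ideal T.sectionRing}, Q ≤ P → (∀ s ∈ P, T.t * s ∈ Q) →
      (Function.support fun i : ℤ => (Polynomial.taylor (a : ℝ) φ).eval (i : ℝ) *
        ((pieceDim T.grade P (k + 1, i + a) : ℝ) -
          pieceDim T.grade Q (k + 1, i + a))).Finite := by
    intro P Q h1 h2
    refine ((finite_support_sub h1 h2 (k + 1)).preimage
      ((Equiv.addRight a).injective.injOn)).subset fun i hi h => hi ?_
    have h' : pieceDim T.grade P (k + 1, i + a) = pieceDim T.grade Q (k + 1, i + a) := h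
    simp [h']
  have hC : Ideal.span {x} * P ⊔ Q ≤ P := sup_le hxP hQP
  have hCt : ∀ s ∈ P, T.t * s ∈ Ideal.span {x} * P ⊔ Q := fun s hs => Submodule.mem_sup_right (ht s hs)
  have hK : Q ≤ P ⊓ Submodule.comap (LinearMap.mulLeft T.sectionRing x) Q :=
    le_inf hQP fun s hs => Ideal.mul_mem_left _ x hs
  have hKt : ∀ s ∈ P ⊓ Submodule.comap (LinearMap.mulLeft T.sectionRing x) Q, T.t * s ∈ Q :=
    fun s hs => ht s hs.1
  rw [hshift, hshift, weightedDim, weightedDim,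
    ← finsum_sub_distrib (hsupp hQP ht) (weightedDim_support hQP ht _ k),
    ← finsum_sub_distrib (hsupp hC hCt) (weightedDim_support hK hKt _ k)]
  refine finsum_congr fun i => ?_
  have h := pieceDim_exact (𝒜 := T.grade) hx hP hQ (k, i)
  rw [Prod.mk_add_mk, add_comm 1 k, add_comm a i] at h
  have h' : (_ : ℝ) = _ := congrArg (Nat.cast (R := ℝ)) h
  push_cast at h'
  rw [← mul_sub, ← mul_sub]
  congr 1
  linarith

/-- Equivariant Hilbert–Serre theorem. -/
theorem eventuallyPoly_weightedDim_of_finset {G : Finset T.sectionRing}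
    (hG : (G : Set T.sectionRing) ⊆ ⋃ j : ℤ, (T.grade (1, j) : Set T.sectionRing))
    (hGspan : T.degreeOneIdeal = Ideal.span G) (L : Finset T.sectionRing) :
    L ⊆ G → ∀ P Q : Ideal T.sectionRing, P.IsHomogeneous T.grade → Q.IsHomogeneous T.grade →
      Q ≤ P → (∀ s ∈ P, T.t * s ∈ Q) → (∀ g ∈ G, g ∉ L → ∀ s ∈ P, g * s ∈ Q) →
      ∀ φ, EventuallyPoly (weightedDim P Q φ) := by
  classical
  -- `L` holds the generators not yet known to annihilate P/Q. Once it is empty, the ideal of degree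
  -- one kills P/Q, which then vanishes in large degrees.
  induction L using Finset.induction_on with
  | empty =>
    intro _ P Q hP hQ hQP ht hGP φ
    have hJ : T.degreeOneIdeal * P ≤ Q := by
      rw [hGspan, Ideal.mul_le]
      intro g hg s hs
      refine Submodule.span_induction (p := fun g _ => g * s ∈ Q)
        (fun g hg => hGP g hg (Finset.notMem_empty g) s hs) ?_ ?_ ?_ hg
      · simp
      · intro x y _ _ hx hy
        rw [add_mul]; exact add_mem hx hy
      · intro a x _ hx
        rw [smul_eq_mul, mul_assoc]; exact Ideal.mul_mem_left _ a hx
    obtain ⟨K, hK⟩ := exists_piece_le hP hJ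
    refine EventuallyPoly.zero.congr (eventually_atTop.2 ⟨K, fun k hk => ?_⟩)
    rw [weightedDim]
    refine finsum_eq_zero_of_forall_eq_zero fun i => ?_
    rw [pieceDim_eq_of_le (hK k hk i) hQP, sub_self, mul_zero]
  | insert x L hx ih =>
    intro hLG P Q hP hQ hQP ht hGP
    obtain ⟨a, hxa⟩ := Set.mem_iUnion.1 (hG (hLG (Finset.mem_insert_self x L)))
    have hxP : Ideal.span {x} * P ≤ P := Ideal.mul_le_right
    have hxmul : ∀ s ∈ P, x * s ∈ Ideal.span {x} * P ⊔ Q := fun s hs =>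
      Submodule.mem_sup_left (Ideal.mem_span_singleton_mul.2 ⟨s, hs, rfl⟩)
    have hsub := (Finset.subset_insert x L).trans hLG
    -- The cokernel P/(xP + Q) and the kernel (P ∩ (Q : x))/Q of multiplication by x are both killed
    -- by x, so the induction hypothesis covers them.
    have hC := ih hsub P (Ideal.span {x} * P ⊔ Q) hP
      (((isHomogeneous_span_singleton hxa).mul hP).sup hQ) (sup_le hxP hQP)
      (fun s hs => Submodule.mem_sup_right (ht s hs)) fun g hg hgL s hs => by
        by_cases hgx : g = x
        · subst hgx
          exact hxmul s hs
        · exact Submodule.mem_sup_right (hGP g hg (by simp [hgx, hgL]) s hs)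
    have hK := ih hsub (P ⊓ Submodule.comap (LinearMap.mulLeft T.sectionRing x) Q) Q
      (hP.inf (isHomogeneous_colon hxa hQ)) hQ (le_inf hQP fun s hs => Ideal.mul_mem_left _ x hs)
      (fun s hs => ht s hs.1) fun g hg hgL s hs => by
        by_cases hgx : g = x
        · subst hgx
          exact hs.2
        · exact hGP g hg (by simp [hgx, hgL]) s hs.1
    -- A second induction, on the degree of φ: the step from k to k + 1 produces the shifted
    -- polynomial, which differs from φ by one of lower degree. So the first difference in k is
    -- eventually polynomial.
    suffices h : ∀ n : ℕ, ∀ φ : Polynomial ℝ, φ.degree < n → EventuallyPoly (weightedDim P Q φ) from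
      fun φ => h (φ.natDegree + 1) φ (Polynomial.degree_le_natDegree.trans_lt
        (by exact_mod_cast Nat.lt_succ_self _))
    intro n
    induction n with
    | zero =>
      intro φ hφ
      have : φ = 0 := by
        rw [← Polynomial.degree_eq_bot]
        exact Nat.WithBot.lt_zero_iff.1 hφ
      subst this
      refine EventuallyPoly.zero.congr (Eventually.of_forall fun k => ?_)
      simp [weightedDim]
    | succ n ihn =>
      intro φ hφ
      by_cases hφ0 : φ = 0
      · exact ihn φ (by rw [hφ0, Polynomial.degree_zero]; exact WithBot.bot_lt_coe _)
      have hdeg : (Polynomial.taylor (a : ℝ) φ - φ).degree < n := by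
        have h1 : (Polynomial.taylor (a : ℝ) φ - φ).degree < (Polynomial.taylor (a : ℝ) φ).degree :=
          Polynomial.degree_sub_lt_left (Polynomial.degree_taylor φ _)
            (by simpa using hφ0) (Polynomial.leadingCoeff_taylor _ _)
        rw [Polynomial.degree_taylor] at h1
        refine h1.trans_le ?_
        rw [Polynomial.degree_eq_natDegree hφ0] at hφ ⊢
        have : φ.natDegree < n + 1 := by exact_mod_cast hφ
        exact_mod_cast Nat.lt_succ_iff.1 this
      refine EventuallyPoly.of_succ_sub ?_
      refine (((hC φ).succ.sub (hK (Polynomial.taylor (a : ℝ) φ))).add (ihn _ hdeg)).congr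
        (Eventually.of_forall fun k => ?_)
      have h1 := weightedDim_succ hQP ht hP hQ hxa hxP φ k
      have h2 := weightedDim_add hQP ht φ (Polynomial.taylor (a : ℝ) φ - φ) k
      rw [add_sub_cancel] at h2
      linarith

variable (T) in
-- The case P = S, Q = tS, with finitely many homogeneous generators of `degreeOneIdeal`.
theorem eventuallyPoly_grDim (φ : Polynomial ℝ) :
    EventuallyPoly fun k => ∑ᶠ i : ℤ, φ.eval (i : ℝ) * grDim (T.filt (r * k)) i := by
  obtain ⟨G, hG, hGspan⟩ := (Submodule.fg_span_iff_fg_span_finset_subset _).1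
    (IsNoetherian.noetherian T.degreeOneIdeal)
  have := eventuallyPoly_weightedDim_of_finset hG hGspan G subset_rfl ⊤ (Ideal.span {T.t})
    (Ideal.IsHomogeneous.top _) (isHomogeneous_span_singleton T.t_mem) le_top
    (fun s _ => Ideal.mul_mem_right _ _ (Ideal.subset_span rfl))
    (fun g hg hg' => absurd hg hg') φ
  refine this.congr (Eventually.of_forall fun k => ?_)
  rw [weightedDim]
  simp only [grDim_filt]

end TestConfiguration

namespace WeightedFlag.Adapted

variable {V : Type u} [AddCommGroup V] [Module ℂ V] {ι : Type} {b : Basis ι ℂ V}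
  {a : ι → ℝ} {F : WeightedFlag V}

theorem mem_iff (h : F.Adapted b a) {j : ι} {x : ℝ} : b j ∈ F.toFun x ↔ a j ≤ x := by
  rw [h, Basis.mem_span_image, b.repr_self, Finsupp.support_single _ one_ne_zero]
  simp

theorem finrank_eq [Fintype ι] (h : F.Adapted b a) (x : ℝ) :
    finrank ℂ (F.toFun x) = Fintype.card {j // a j ≤ x} := by
  have hrange : b '' {j | a j ≤ x} = Set.range (b ∘ (Subtype.val : {j // a j ≤ x} → ι)) := by
    rw [Set.range_comp, Subtype.range_coe_subtype]
  rw [h, hrange]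
  exact finrank_span_eq_card (b.linearIndependent.comp _ Subtype.val_injective)

end WeightedFlag.Adapted

namespace TestConfiguration

variable {X : PolarisedVariety.{u}} {r : ℕ} {T : TestConfiguration.{u, v} X r} {m : ℕ} {hm : r ∣ m}
  {ι : Type} {b : Basis ι ℂ (X.sec m)} {a : ι → ℝ}

theorem flag_intCast (i : ℤ) : (T.flag m hm).toFun (i : ℝ) = T.filt m i := by
  simp [flag]

/-- The flag at aⱼ equals the flag at ⌊aⱼ⌋, so bⱼ already occurs at the floor. -/
theorem exists_int_weights (h : (T.flag m hm).Adapted b a) : ∃ z : ι → ℤ, ∀ j, a j = z j := by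
  refine ⟨fun j => ⌊a j⌋, fun j => le_antisymm ?_ (Int.floor_le _)⟩
  rw [← h.mem_iff]
  have : b j ∈ (T.flag m hm).toFun (a j) := h.mem_iff.2 le_rfl
  simpa [flag] using this

variable [Fintype ι]

theorem grDim_eq_card (h : (T.flag m hm).Adapted b a) (i : ℤ) :
    grDim (T.filt m) i = Fintype.card {j // a j = i} := by
  classical
  obtain ⟨z, hz⟩ := exists_int_weights h
  have h1 := grDim_add (T.filt_mono m) i
  rw [← flag_intCast (hm := hm), ← flag_intCast (hm := hm), h.finrank_eq, h.finrank_eq] at h1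
  have h2 : Fintype.card {j // a j ≤ (i : ℝ)} =
      Fintype.card {j // a j = i} + Fintype.card {j // a j ≤ ((i - 1 : ℤ) : ℝ)} := by
    rw [← Fintype.card_subtype_or_disjoint]
    · refine Fintype.card_congr (Equiv.subtypeEquivRight fun j => ?_)
      rw [hz]
      norm_cast
      omega
    · rw [Pi.disjoint_iff]
      intro j
      rw [Prop.disjoint_iff, hz]
      norm_cast
      omega
  omega

theorem finsum_mul_grDim (h : (T.flag m hm).Adapted b a) (f : ℝ → ℝ) :
    ∑ᶠ i : ℤ, f i * grDim (T.filt m) i = ∑ j, f (a j) := by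
  classical
  obtain ⟨z, hz⟩ := exists_int_weights h
  have hcard : ∀ i : ℤ, grDim (T.filt m) i = (Finset.univ.filter fun j => z j = i).card := fun i => by
    rw [grDim_eq_card h, Fintype.card_subtype]
    congr 1
    ext j
    simp [hz]
  rw [finsum_eq_sum_of_support_subset (s := Finset.univ.image z)]
  · simp only [hz]
    rw [Finset.sum_comp (fun i : ℤ => f i) z]
    refine Finset.sum_congr rfl fun i _ => ?_
    rw [hcard, nsmul_eq_mul, mul_comm]
  · intro i hi
    by_contra hout
    refine hi ?_
    have : (Finset.univ.filter fun j => z j = i) = ∅ :=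
      Finset.filter_eq_empty_iff.2 fun j _ hj => hout (by simpa using ⟨j, hj⟩)
    simp [hcard, this]

theorem weight_eq (h : (T.flag m hm).Adapted b a) : T.weight m = -∑ j, a j := by
  rw [weight, finsum_mul_grDim h fun x => -x, Finset.sum_neg_distrib]

theorem traceSq_eq (h : (T.flag m hm).Adapted b a) : T.traceSq m = ∑ j, a j * a j := by
  rw [traceSq, finsum_mul_grDim h fun x => x ^ 2]
  simp only [sq]

theorem hilbert_eq (b : Basis ι ℂ (X.sec m)) : X.hilbert m = Fintype.card ι := by
  rw [PolarisedVariety.hilbert, Module.finrank_eq_card_basis b]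

theorem sub_div_card (a c : ι → ℝ) : ∑ j, a j * c j - (∑ j, a j) * (∑ j, c j) / Fintype.card ι =
    weightCov a c / Fintype.card ι := by
  -- For empty `ι` both sides vanish, by the convention on division by zero.
  rcases isEmpty_or_nonempty ι with h | h
  · simp [weightCov]
  have : (Fintype.card ι : ℝ) ≠ 0 := by exact_mod_cast Fintype.card_ne_zero
  rw [weightCov]
  field_simp

/-- `d(m) - w(m)² / h(m)`, the squared norm of the traceless part of a generator. -/
def normSq (T : TestConfiguration.{u, v} X r) (m : ℕ) : ℝ :=
  T.traceSq m - T.weight m ^ 2 / X.hilbert m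

theorem normSq_eq (h : (T.flag m hm).Adapted b a) :
    T.normSq m = weightCov a a / X.hilbert m := by
  rw [normSq, traceSq_eq h, weight_eq h, hilbert_eq b, ← sub_div_card, neg_sq, sq]

section Pair

variable {r' : ℕ} {T' : TestConfiguration.{u, v} X r'} {hm' : r' ∣ m} {c : ι → ℝ}

theorem pBar_eq (h : (T.flag m hm).Adapted b a) (h' : (T'.flag m hm').Adapted b c) :
    T.pBar T' m hm hm' = weightCov a c / X.hilbert m := by
  rw [pBar, WeightedFlag.tracePairing_eq h h', weight_eq h, weight_eq h', hilbert_eq b,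
    ← sub_div_card, neg_mul_neg]

theorem pBar_sq_le : T.pBar T' m hm hm' ^ 2 ≤ T.normSq m * T'.normSq m := by
  obtain ⟨ι, _, b, a, c, h, h'⟩ := WeightedFlag.exists_adapted (T.flag m hm) (T'.flag m hm')
  rw [pBar_eq h h', normSq_eq h, normSq_eq h', div_pow, div_mul_div_comm, ← sq]
  exact div_le_div_of_nonneg_right (weightCov_sq_le a c) (sq_nonneg _)

/-- Dualising negates both weight vectors, and Killing form and P̄ are the multiples 2 and 1/h of
the same `weightCov`. -/
theorem killingPairing_div (D : ℝ) : (T.dualFlag m hm).killingPairing (T'.dualFlag m hm') /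
    (2 * X.hilbert m * D) = T.pBar T' m hm hm' / D := by
  classical
  obtain ⟨ι, _, b, a, c, h, h'⟩ := WeightedFlag.exists_adapted (T.flag m hm) (T'.flag m hm')
  rw [pBar_eq h h', dualFlag, dualFlag, WeightedFlag.killingPairing_eq h.dual h'.dual,
    weightCov_neg, mul_assoc, mul_div_mul_left _ _ two_ne_zero, div_div]

/-- Positivity of `normSq` excludes constant weights, so both flags are nontrivial and the default
value 0 does not intervene. -/
theorem levelDist_eq (hpos : 0 < T.normSq m) (hpos' : 0 < T'.normSq m) :
    T.levelDist T' m hm hm' =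
      Real.arccos (T.pBar T' m hm hm' / (√(T.normSq m) * √(T'.normSq m))) := by
  classical
  obtain ⟨ι, _, b, a, c, h, h'⟩ := WeightedFlag.exists_adapted (T.flag m hm) (T'.flag m hm')
  rw [normSq_eq h] at hpos
  rw [normSq_eq h'] at hpos'
  have hh : 0 < X.hilbert m := by
    refine lt_of_le_of_ne (Nat.cast_nonneg _) fun h0 => ?_
    rw [← h0, div_zero] at hpos
    exact lt_irrefl _ hpos
  have ha : 0 < weightCov a a := (div_pos_iff_of_pos_right hh).1 hpos
  have hc : 0 < weightCov c c := (div_pos_iff_of_pos_right hh).1 hpos'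
  have hnt : ¬ (T.dualFlag m hm).IsTrivial := h.dual.not_isTrivial (by rwa [weightCov_neg])
  have hnt' : ¬ (T'.dualFlag m hm').IsTrivial := h'.dual.not_isTrivial (by rwa [weightCov_neg])
  rw [levelDist, dif_pos ⟨hnt, hnt'⟩, point, point]
  refine (WeightedFlag.titsDist_eq h.dual h'.dual hnt hnt').trans ?_
  rw [weightCov_neg, weightCov_neg, weightCov_neg, normSq_eq h, normSq_eq h', pBar_eq h h',
    Real.sqrt_div ha.le, Real.sqrt_div hc.le, div_mul_div_comm, Real.mul_self_sqrt hh.le,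
    div_div_div_cancel_right₀ hh.ne']

end Pair

/-! ### Asymptotics -/

/-- If all of H⁰(X, Lʳ) extends to sections of weight c, then k-fold products, which span H⁰(X,
Lʳᵏ), extend with weight c k. -/
theorem exists_sec_le_map (T : TestConfiguration.{u, v} X r) : ∃ c : ℕ, ∀ k : ℕ,
    X.sec (r * k) ≤ (T.grade (k, (c * k : ℕ))).map T.fibre.toLinearMap := by
  obtain ⟨i, hi⟩ := T.exists_filt_top r dvd_rfl
  have hc : T.filt r (i.toNat : ℤ) = ⊤ := top_le_iff.1 (hi ▸ T.filt_mono r (Int.self_le_toNat i))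
  refine ⟨i.toNat, fun k => ?_⟩
  induction k with
  | zero =>
    rw [mul_zero, X.sec_zero, Submodule.one_le]
    exact ⟨1, SetLike.one_mem_graded T.grade, map_one T.fibre⟩
  | succ k ih =>
    rw [mul_add, mul_one, X.sec_add, Submodule.mul_le]
    intro x hx y hy
    obtain ⟨σ, hσ, rfl⟩ := ih hx
    have hy' : (⟨y, hy⟩ : X.sec r) ∈ T.filt r (i.toNat : ℤ) := by rw [hc]; trivial
    obtain ⟨τ, hτ, hτy⟩ := hy'
    rw [Nat.div_self T.exponent_pos] at hτ
    refine ⟨σ * τ, ?_, ?_⟩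
    · have := SetLike.mul_mem_graded hσ hτ
      rw [Prod.mk_add_mk] at this
      rw [mul_add, mul_one]
      exact_mod_cast this
    · exact (map_mul T.fibre σ τ).trans (congrArg _ hτy)

variable (T) in
-- The upper bound comes from `exists_sec_le_map`, the lower one from `exists_weight_bound`.
theorem exists_abs_weight_le : ∃ C : ℕ, ∀ (k : ℕ) {ι : Type} (b : Basis ι ℂ (X.sec (r * k)))
    (a : ι → ℝ), (T.flag (r * k) (dvd_mul_right r k)).Adapted b a → ∀ j, |a j| ≤ C * k := by
  obtain ⟨c, hc⟩ := T.exists_weight_bound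
  obtain ⟨c', hc'⟩ := T.exists_sec_le_map
  refine ⟨max c.natAbs c', fun k ι b a h j => ?_⟩
  have htop : T.filt (r * k) (c' * k : ℕ) = ⊤ := by
    rw [eq_top_iff]
    rintro ⟨s, hs⟩ -
    rw [filt, Nat.mul_div_cancel_left k T.exponent_pos]
    exact hc' k hs
  have hupper : a j ≤ (c' * k : ℕ) := by
    have : b j ∈ (T.flag (r * k) (dvd_mul_right r k)).toFun ((c' * k : ℕ) : ℤ) := by
      rw [flag_intCast, htop]; trivial
    simpa using h.mem_iff.1 this
  have hlower : -(c * k : ℝ) ≤ a j := by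
    by_contra! hlt
    have hmem : b j ∈ (T.flag (r * k) (dvd_mul_right r k)).toFun (a j) := h.mem_iff.2 le_rfl
    have hbot : T.filt (r * k) ⌊a j⌋ = ⊥ := by
      rw [filt, Nat.mul_div_cancel_left k T.exponent_pos, hc k _ (by
        rw [Int.floor_lt]; exact_mod_cast hlt), Submodule.map_bot]
      exact LinearMap.ker_eq_bot.2 (X.sec _).injective_subtype
    rw [show (T.flag (r * k) (dvd_mul_right r k)).toFun (a j) = T.filt (r * k) ⌊a j⌋ from rfl,
      hbot, Submodule.mem_bot] at hmem
    exact b.ne_zero j hmem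
  have h1 : (c : ℝ) ≤ (max c.natAbs c' : ℕ) := by
    have : c ≤ (max c.natAbs c' : ℕ) := by omega
    exact (Int.cast_le.2 this).trans_eq (Int.cast_natCast _)
  have h2 : (c' : ℝ) ≤ (max c.natAbs c' : ℕ) := by exact_mod_cast le_max_right _ _
  have hk : (0 : ℝ) ≤ k := Nat.cast_nonneg k
  rw [Nat.cast_mul] at hupper
  rw [abs_le]
  constructor
  · nlinarith
  · nlinarith

variable (T) in
/-- `∑ᵢ iᵉ dim gr_i H⁰(X, Lᵐ)` grows like `mⁿ⁺ᵉ`. -/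
theorem exists_tendsto_moment (e : ℕ) : ∃ L, Tendsto (fun k : ℕ =>
    (∑ᶠ i : ℤ, (i : ℝ) ^ e * grDim (T.filt (r * k)) i) / ((r * k : ℕ) : ℝ) ^ (X.dim + e))
    atTop (nhds L) := by
  obtain ⟨C, hC⟩ := T.exists_abs_weight_le
  obtain ⟨H, -, -, hH, -⟩ := X.exists_hilbert_bounds
  have hr : (1 : ℝ) ≤ r := by exact_mod_cast T.exponent_pos
  have hpoly := T.eventuallyPoly_grDim (Polynomial.X ^ e)
  simp only [Polynomial.eval_pow, Polynomial.eval_X] at hpoly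
  -- There are h(rk) ≤ |H| (2rk)ⁿ terms, since rk + 1 ≤ 2rk, each at most (C k)ᵉ.
  obtain ⟨L, hL⟩ := hpoly.exists_tendsto (e := X.dim + e) (C := |H| * (2 * r) ^ X.dim * C ^ e) (by
    filter_upwards [eventually_ge_atTop 1] with k hk
    obtain ⟨ι, _, b, a, -, h, -⟩ := WeightedFlag.exists_adapted
      (T.flag (r * k) (dvd_mul_right r k)) (T.flag (r * k) (dvd_mul_right r k))
    rw [finsum_mul_grDim h fun x => x ^ e]
    have hk' : (1 : ℝ) ≤ k := by exact_mod_cast hk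
    have hcard : (Fintype.card ι : ℝ) ≤ |H| * (2 * r * k) ^ X.dim := by
      rw [← hilbert_eq b]
      refine (hH (r * k)).trans ?_
      refine mul_le_mul (le_abs_self H) ?_ (by positivity) (abs_nonneg H)
      gcongr
      push_cast
      nlinarith
    calc |∑ j, a j ^ e| ≤ ∑ j, |a j ^ e| := Finset.abs_sum_le_sum_abs _ _
      _ ≤ ∑ _j : ι, ((C : ℝ) * k) ^ e := Finset.sum_le_sum fun j _ => by
          rw [abs_pow]
          exact pow_le_pow_left₀ (abs_nonneg _) (hC k b a h j) e
      _ = Fintype.card ι * ((C : ℝ) * k) ^ e := by simp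
      _ ≤ |H| * (2 * r * k) ^ X.dim * ((C : ℝ) * k) ^ e := by gcongr
      _ = _ := by rw [mul_pow _ (k : ℝ), mul_pow _ (k : ℝ)]; ring)
  refine ⟨L / (r : ℝ) ^ (X.dim + e), (hL.div_const _).congr fun k => ?_⟩
  rw [div_div, ← mul_pow, mul_comm (k : ℝ)]
  push_cast
  rfl

theorem moment_zero (k : ℕ) : ∑ᶠ i : ℤ, (i : ℝ) ^ 0 * grDim (T.filt (r * k)) i =
    X.hilbert (r * k) := by
  obtain ⟨ι, _, b, a, -, h, -⟩ := WeightedFlag.exists_adapted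
    (T.flag (r * k) (dvd_mul_right r k)) (T.flag (r * k) (dvd_mul_right r k))
  rw [finsum_mul_grDim h fun x => x ^ 0, hilbert_eq b]
  simp

theorem moment_one (m : ℕ) : ∑ᶠ i : ℤ, (i : ℝ) ^ 1 * grDim (T.filt m) i = -T.weight m := by
  rw [weight, ← finsum_neg_distrib]
  simp

/-- Convergence of the moments of order 0, 1, 2 identifies the `limUnder` coefficients in the norm.
The lower bound on h makes the denominator a₀ positive, and positivity of the norm allows the square
root to be undone. -/
theorem tendsto_normSq (hT : 0 < T.l2Norm) :
    Tendsto (fun k : ℕ => T.normSq (r * k) / ((r * k : ℕ) : ℝ) ^ (X.dim + 2)) atTop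
      (nhds (T.l2Norm ^ 2)) := by
  obtain ⟨L₀, h₀⟩ := T.exists_tendsto_moment 0
  obtain ⟨L₁, h₁⟩ := T.exists_tendsto_moment 1
  obtain ⟨L₂, h₂⟩ := T.exists_tendsto_moment 2
  simp only [moment_zero, add_zero] at h₀
  simp only [moment_one] at h₁
  have h₁' : Tendsto (fun k : ℕ => T.weight (r * k) / ((r * k : ℕ) : ℝ) ^ (X.dim + 1)) atTop
      (nhds (-L₁)) := h₁.neg.congr fun k => by ring
  obtain ⟨-, c, hc, -, hcX⟩ := X.exists_hilbert_bounds
  have hpos : ∀ᶠ k : ℕ in atTop, (0 : ℝ) < ((r * k : ℕ) : ℝ) := by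
    filter_upwards [eventually_gt_atTop 0] with k hk
    exact_mod_cast Nat.mul_pos T.exponent_pos hk
  have hL₀ : 0 < L₀ := hc.trans_le (ge_of_tendsto h₀ (by
    filter_upwards [hpos] with k hk
    rw [le_div_iff₀ (by positivity)]
    exact hcX _))
  have e₀ : leadingCoeff r X.dim X.hilbert = L₀ := h₀.limUnder_eq
  have e₁ : leadingCoeff r (X.dim + 1) T.weight = -L₁ := h₁'.limUnder_eq
  have e₂ : leadingCoeff r (X.dim + 2) T.traceSq = L₂ := h₂.limUnder_eq
  have hnorm : T.l2Norm ^ 2 = L₂ - (-L₁) ^ 2 / L₀ := by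
    rw [l2Norm, e₀, e₁, e₂, Real.sqrt_pos] at hT
    rw [l2Norm, e₀, e₁, e₂, Real.sq_sqrt hT.le]
  rw [hnorm]
  refine (h₂.sub ((h₁'.pow 2).div h₀ hL₀.ne')).congr' ?_
  filter_upwards [hpos] with k hk
  rw [normSq, ← traceSq, sub_div]
  congr 1
  have h : X.hilbert (r * k) ≠ 0 := ((mul_pos hc (pow_pos hk _)).trans_le (hcX _)).ne'
  simp only [Pi.div_apply]
  field_simp
  ring

end TestConfiguration

/-! ### Upper limits -/

/-- Eventually u ≤ w + ε for every ε > 0; the bound M makes the real upper limits meaningful. -/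
theorem limsup_le_of_tendsto_sub_zero {u w : ℕ → ℝ} {M : ℝ} (hw : ∀ᶠ k in atTop, |w k| ≤ M)
    (hu : ∀ᶠ k in atTop, |u k| ≤ M) (h : Tendsto (fun k => u k - w k) atTop (nhds 0)) :
    limsup u atTop ≤ limsup w atTop := by
  have hwb : IsBoundedUnder (· ≤ ·) atTop w := ⟨M, hw.mono fun k hk => (abs_le.1 hk).2⟩
  have hwc : IsCoboundedUnder (· ≤ ·) atTop w :=
    IsBoundedUnder.isCoboundedUnder_le ⟨-M, hw.mono fun k hk => (abs_le.1 hk).1⟩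
  have huc : IsCoboundedUnder (· ≤ ·) atTop u :=
    IsBoundedUnder.isCoboundedUnder_le ⟨-M, hu.mono fun k hk => (abs_le.1 hk).1⟩
  refine le_of_forall_pos_le_add fun ε hε => ?_
  have hmono : Monotone fun x : ℝ => x + ε := fun x y hxy => by simpa using hxy
  rw [hmono.map_limsup_of_continuousAt w (by fun_prop) hwb hwc]
  refine limsup_le_limsup ?_ huc ⟨M + ε, ?_⟩
  · filter_upwards [h.eventually (gt_mem_nhds hε)] with k hk
    simp only [Function.comp_apply]
    linarith
  · rw [eventually_map]
    filter_upwards [hw] with k hk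
    simpa using (abs_le.1 hk).2

theorem limsup_eq_of_tendsto_sub_zero {u w : ℕ → ℝ} {M : ℝ} (hw : ∀ᶠ k in atTop, |w k| ≤ M)
    (hu : ∀ᶠ k in atTop, |u k| ≤ M) (h : Tendsto (fun k => u k - w k) atTop (nhds 0)) :
    limsup u atTop = limsup w atTop :=
  le_antisymm (limsup_le_of_tendsto_sub_zero hw hu h)
    (limsup_le_of_tendsto_sub_zero hu hw (by simpa using h.neg))

/-- A continuous decreasing function exchanges upper and lower limits, and since |p / d| ≤ 1,
replacing d by its limit D changes p by o(1). -/
theorem liminf_arccos_div {p d : ℕ → ℝ} {D : ℝ} (hD : 0 < D) (hd : Tendsto d atTop (nhds D))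
    (hp : ∀ᶠ k in atTop, |p k| ≤ d k) :
    liminf (fun k => Real.arccos (p k / d k)) atTop = Real.arccos (limsup p atTop / D) := by
  have hx : ∀ᶠ k in atTop, |p k / d k| ≤ 1 := by
    filter_upwards [hp, hd.eventually (lt_mem_nhds hD)] with k h1 h2
    rw [abs_div, abs_of_pos h2, div_le_one h2]
    exact h1
  have hxb : IsBoundedUnder (· ≤ ·) atTop fun k => p k / d k :=
    ⟨1, hx.mono fun k hk => (abs_le.1 hk).2⟩
  have hxc : IsCoboundedUnder (· ≤ ·) atTop fun k => p k / d k :=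
    IsBoundedUnder.isCoboundedUnder_le ⟨-1, hx.mono fun k hk => (abs_le.1 hk).1⟩
  have hpb : ∀ᶠ k in atTop, |p k| ≤ D + 1 := by
    filter_upwards [hp, hd.eventually (gt_mem_nhds (lt_add_one D))] with k h1 h2
    exact h1.trans h2.le
  have hanti := Real.antitone_arccos.map_limsup_of_continuousAt (fun k => p k / d k)
    Real.continuous_arccos.continuousAt hxb hxc
  refine hanti.symm.trans (congrArg _ ?_)
  rw [eq_div_iff hD.ne']
  have hmono : Monotone fun x : ℝ => x * D := fun x y hxy => mul_le_mul_of_nonneg_right hxy hD.le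
  rw [hmono.map_limsup_of_continuousAt (fun k => p k / d k) (by fun_prop) hxb hxc]
  refine limsup_eq_of_tendsto_sub_zero (M := D + 1) hpb ?_ ?_
  · filter_upwards [hx] with k hk
    simp only [Function.comp_apply, abs_mul, abs_of_pos hD]
    nlinarith
  · have h0 : Tendsto (fun k => ‖D - d k‖) atTop (nhds 0) := by
      simpa using ((tendsto_const_nhds (x := D)).sub hd).norm
    refine squeeze_zero_norm' ?_ h0
    filter_upwards [hx, hd.eventually (lt_mem_nhds hD)] with k h1 h2
    have : p k / d k * D - p k = p k / d k * (D - d k) := by field_simp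
    rw [Function.comp_apply, this, norm_mul]
    exact mul_le_of_le_one_left (norm_nonneg _) h1

theorem mainTheorem9 {X : PolarisedVariety.{u}} {r r' : ℕ}
    (T : TestConfiguration.{u, v} X r) (T' : TestConfiguration.{u, v} X r')
    (hT : 0 < T.l2Norm) (hT' : 0 < T'.l2Norm) :
    T.rho T' = Real.arccos (T.scalarProduct T' / (T.l2Norm * T'.l2Norm)) ∧
    T.scalarProduct T' = Filter.limsup (fun k : ℕ =>
      (T.dualFlag (k * (r * r')) (TestConfiguration.dvd_left r r' k)).killingPairing
        (T'.dualFlag (k * (r * r')) (TestConfiguration.dvd_right r r' k)) /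
      (2 * X.hilbert (k * (r * r')) * ((k * (r * r') : ℕ) : ℝ) ^ (X.dim + 2))) Filter.atTop := by
  refine ⟨?_, ?_⟩
  · have hr := T.exponent_pos
    have hr' := T'.exponent_pos
    -- The levels k r r' are the multiples r (k r') of r, so the limit along multiples of r
    -- restricts to them.
    have hN : Tendsto (fun k : ℕ => T.normSq (k * (r * r')) /
        ((k * (r * r') : ℕ) : ℝ) ^ (X.dim + 2)) atTop (nhds (T.l2Norm ^ 2)) := by
      refine ((TestConfiguration.tendsto_normSq hT).comp
        (tendsto_id.atTop_mul_const' hr')).congr fun k => ?_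
      have : r * (k * r') = k * (r * r') := by ring
      simp only [Function.comp_apply, id, this]
    have hN' : Tendsto (fun k : ℕ => T'.normSq (k * (r * r')) /
        ((k * (r * r') : ℕ) : ℝ) ^ (X.dim + 2)) atTop (nhds (T'.l2Norm ^ 2)) := by
      refine ((TestConfiguration.tendsto_normSq hT').comp
        (tendsto_id.atTop_mul_const' hr)).congr fun k => ?_
      have : r' * (k * r) = k * (r * r') := by ring
      simp only [Function.comp_apply, id, this]
    have hd := hN.sqrt.mul hN'.sqrt
    rw [Real.sqrt_sq hT.le, Real.sqrt_sq hT'.le] at hd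
    have hm : ∀ᶠ k : ℕ in atTop, (0 : ℝ) < ((k * (r * r') : ℕ) : ℝ) ^ (X.dim + 2) := by
      filter_upwards [eventually_gt_atTop 0] with k hk
      have : 0 < k * (r * r') := by positivity
      positivity
    -- The limits of the normalised `normSq` are positive, so `levelDist_eq` applies for all large
    -- k.
    have hpos := hm.and ((hN.eventually (lt_mem_nhds (by positivity))).and
      (hN'.eventually (lt_mem_nhds (by positivity))))
    rw [TestConfiguration.scalarProduct, ← liminf_arccos_div (mul_pos hT hT') hd,
      TestConfiguration.rho]
    · refine liminf_congr ?_
      filter_upwards [hpos] with k hk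
      obtain ⟨h0, h1, h2⟩ := hk
      rw [TestConfiguration.levelDist_eq ((div_pos_iff_of_pos_right h0).1 h1)
        ((div_pos_iff_of_pos_right h0).1 h2), Real.sqrt_div ((div_pos_iff_of_pos_right h0).1 h1).le,
        Real.sqrt_div ((div_pos_iff_of_pos_right h0).1 h2).le, div_mul_div_comm,
        Real.mul_self_sqrt h0.le, div_div_div_cancel_right₀ h0.ne']
    · filter_upwards [hpos] with k hk
      obtain ⟨h0, h1, h2⟩ := hk
      -- Cauchy–Schwarz in the form `pBar_sq_le`, divided by the square of mⁿ⁺².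
      rw [← Real.sqrt_mul h1.le, div_mul_div_comm, ← sq]
      refine Real.abs_le_sqrt ?_
      rw [div_pow]
      exact div_le_div_of_nonneg_right TestConfiguration.pBar_sq_le (sq_nonneg _)
  · rw [TestConfiguration.scalarProduct]
    simp only [TestConfiguration.killingPairing_div]

end
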